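/- Let $\gamma$ be Euler's constant and $\psi=\Gamma'/\Gamma$. For every real $x>0$, $$\begin{aligned} -\gamma =\;& \frac{\pi}{3}\log x+\frac{1}{4\pi x^2}+\frac{\pi\log|2\sin(\pi x)|}{2\sinh^2(\pi x)}-\sum_{k=1}^\infty\frac{x^2}{k(k^2+x^2)}\\ &+\sum_{k=1}^\infty\frac{2k}{(k^2+x^2)(e^{2\pi k}-1)}-\frac{\pi}{2}\sum_{k=1}^\infty\frac{\log|k^4-x^4|}{\sinh^2(\pi k)}\\ &-2\pi\sum_{k=1}^\infty e^{-2\pi kx}\left(k^2\sum_{n=1}^\infty\frac{\sin(2\pi nx)}{k^2+n^2}-k^3\sum_{n=1}^\infty\frac{\cos(2\pi nx)}{n(k^2+n^2)}\right), \end{aligned}\tag{17}$$ where all the series converge absolutely. When $x=m$ is a positive integer, the third term and the $k=m$ term of the sum with $\log|k^4-x^4|$ are singular, and their sum is replaced by its limit $$\lim_{x\to m}\left(\frac{\pi\log|2\sin(\pi x)|}{2\sinh^2(\pi x)}-\frac{\pi}{2}\,\frac{\log|m^4-x^4|}{\sinh^2(\pi m)}\right)=\frac{\pi\left(\log\pi-\log(2m^3)\right)}{2\sinh^2(\pi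 m)} .$$ Moreover, (17) is equivalent to the formula $$\begin{aligned} \psi(x+1)=\;&\frac{\pi}{3}\log x+\frac{1}{2x}-\frac{1}{4\pi x^2}+\frac{\pi\cot(\pi x)}{e^{2\pi x}-1}+\frac{\pi\log|2\sin(\pi x)|}{2\sinh^2(\pi x)}\\ &+\sum_{k=1}^\infty\frac{2k}{(e^{2\pi k}-1)(k^2-x^2)}-\frac{\pi}{2}\sum_{k=1}^\infty\frac{\log|k^4-x^4|}{\sinh^2(\pi k)}\\ &-2\pi\sum_{k=1}^\infty e^{-2\pi kx}\left(k^2\sum_{n=1}^\infty\frac{\sin(2\pi nx)}{k^2+n^2}-k^3\sum_{n=1}^\infty\frac{\cos(2\pi nx)}{n(k^2+n^2)}\right) \end{aligned}\tag{1}$$ in the following sense: for every real $x>0$ that is not an integer, the left side minus the right side of (1) equals the left side minus the right side of (17); in particular (1) holds at $x$ if and only if (17) does. -/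

import Mathlib

open Filter Topology

noncomputable section

namespace RamanujanPsi

/-- `ψ = Γ'/Γ` on the real line. -/
def psi (x : ℝ) : ℝ := deriv Real.Gamma x / Real.Gamma x

/-- `x² / (k (k² + x²))` -/
def ratTerm (x : ℝ) (k : ℕ+) : ℝ := x ^ 2 / ((k : ℝ) * ((k : ℝ) ^ 2 + x ^ 2))

/-- `2k / ((k² + x²)(e^{2πk} - 1))` -/
def expPlusTerm (x : ℝ) (k : ℕ+) : ℝ :=
  2 * (k : ℝ) / (((k : ℝ) ^ 2 + x ^ 2) * (Real.exp (2 * Real.pi * k) - 1))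

/-- `2k / ((e^{2πk} - 1)(k² - x²))` -/
def expMinusTerm (x : ℝ) (k : ℕ+) : ℝ :=
  2 * (k : ℝ) / ((Real.exp (2 * Real.pi * k) - 1) * ((k : ℝ) ^ 2 - x ^ 2))

/-- `log |k⁴ - x⁴| / sinh²(πk)` -/
def logTerm (x : ℝ) (k : ℕ+) : ℝ :=
  Real.log |(k : ℝ) ^ 4 - x ^ 4| / Real.sinh (Real.pi * k) ^ 2

/-- `sin(2πnx) / (k² + n²)` -/
def sinTerm (x : ℝ) (k n : ℕ+) : ℝ :=
  Real.sin (2 * Real.pi * n * x) / ((k : ℝ) ^ 2 + (n : ℝ) ^ 2)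

/-- `cos(2πnx) / (n (k² + n²))` -/
def cosTerm (x : ℝ) (k n : ℕ+) : ℝ :=
  Real.cos (2 * Real.pi * n * x) / ((n : ℝ) * ((k : ℝ) ^ 2 + (n : ℝ) ^ 2))

/-- `e^{-2πkx} (k² ∑ₙ sin(2πnx)/(k²+n²) - k³ ∑ₙ cos(2πnx)/(n(k²+n²)))` -/
def trigTerm (x : ℝ) (k : ℕ+) : ℝ :=
  Real.exp (-(2 * Real.pi * k * x)) *
    ((k : ℝ) ^ 2 * ∑' n : ℕ+, sinTerm x k n - (k : ℝ) ^ 3 * ∑' n : ℕ+, cosTerm x k n)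

/-- `π log|2 sin(πx)| / (2 sinh²(πx))` -/
def logSin (x : ℝ) : ℝ :=
  Real.pi * Real.log |2 * Real.sin (Real.pi * x)| / (2 * Real.sinh (Real.pi * x) ^ 2)

/-- The right-hand side of the formula for `-γ` (at `x > 0` not an integer). -/
def gammaRHS (x : ℝ) : ℝ :=
  Real.pi / 3 * Real.log x + 1 / (4 * Real.pi * x ^ 2) + logSin x
    - ∑' k : ℕ+, ratTerm x k + ∑' k : ℕ+, expPlusTerm x k
    - Real.pi / 2 * ∑' k : ℕ+, logTerm x k
    - 2 * Real.pi * ∑' k : ℕ+, trigTerm x k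

/-- The limit, as `x → m`, of `logSin x - (π/2) logTerm x m`, the sum of the two terms of
`gammaRHS` that are singular at the positive integer `m`. -/
def logLimit (m : ℕ+) : ℝ :=
  Real.pi * (Real.log Real.pi - Real.log (2 * (m : ℝ) ^ 3)) /
    (2 * Real.sinh (Real.pi * m) ^ 2)

/-- The right-hand side of the formula for `-γ` at a positive integer `m`, the two terms that
are singular there being replaced by the limit of their sum. -/
def gammaRHSInt (m : ℕ+) : ℝ :=
  Real.pi / 3 * Real.log m + 1 / (4 * Real.pi * (m : ℝ) ^ 2) + logLimit m
    - ∑' k : ℕ+, ratTerm m k + ∑' k : ℕ+, expPlusTerm m k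
    - Real.pi / 2 * ∑' k : {k : ℕ+ // k ≠ m}, logTerm m k
    - 2 * Real.pi * ∑' k : ℕ+, trigTerm m k

/-- The right-hand side of Ramanujan's formula for `ψ(x + 1)` (at `x > 0` not an integer). -/
def psiRHS (x : ℝ) : ℝ :=
  Real.pi / 3 * Real.log x + 1 / (2 * x) - 1 / (4 * Real.pi * x ^ 2)
    + Real.pi * Real.cot (Real.pi * x) / (Real.exp (2 * Real.pi * x) - 1) + logSin x
    + ∑' k : ℕ+, expMinusTerm x k
    - Real.pi / 2 * ∑' k : ℕ+, logTerm x k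
    - 2 * Real.pi * ∑' k : ℕ+, trigTerm x k

end RamanujanPsi

end

namespace RamanujanPsi

/-! The right-hand side of the formula for $-\gamma$ is constant on $(0,\infty)$, and its behaviour
at infinity identifies the constant.

Away from the integers its derivative vanishes for two reasons. The $k$-th trigonometric term is
built so that differentiation cancels every series in $n$ and leaves only $-2\pi k^2e^{-2\pi
kx}\log|2\sin\pi x|$; summed over $k$, this cancels the part of the derivative of `logSin` that
contains the logarithm (`hasDerivAt_tsum_trigTerm`, `hasDerivAt_logSin`). What remains is a rational
series in $x$, which the partial fraction expansion of $\cot(\pi x)/\sinh^2(\pi x)$ sums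
(`hasSum_cot_mul_csch_sq`, `hasDerivAt_gammaRHS`). At the integers the limit of the two singular
terms makes the extension `gammaExt` continuous, so it is constant (`gammaExt_eq`).

Along $x=N+\frac12$ the right-hand side is $a\log x-\gamma+o(1)$ with
$a=\frac\pi3-1-2\pi\sum_k\sinh^{-2}(\pi k)$ (`tendsto_gammaRHS_halfInt`). A constant function forces
$a=0$, and then the constant is $-\gamma$; the value of $\sum_k\sinh^{-2}(\pi k)$ need not be known
beforehand.

The comparison with the formula for $\psi(x+1)$ is independent of this: the logarithmic and
trigonometric series are common to both, and the difference of the rest is the partial fraction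
expansion of $\cot(\pi x)\coth(\pi x)$ (`hasSum_cot_mul_coth`) together with the series for $\psi$
(`hasSum_psi`). -/

lemma _root_.HasSum.congr_terms {ι M : Type*} [AddCommMonoid M] [TopologicalSpace M]
    {f g : ι → M} {a : M} (h : HasSum f a)
    (e : ∀ n, g n = f n) : HasSum g a :=
  (funext e : g = f) ▸ h

/-! ### Expansions of the cotangent and its hyperbolic relatives -/

/-- Mittag-Leffler expansion of the cotangent, with paired terms. -/
lemma hasSum_complex_cot {z : ℂ} (hz : z ∈ Complex.integerComplement) :
    HasSum (fun n : ℕ+ => 2 * z / (z ^ 2 - (n : ℂ) ^ 2))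
      (Real.pi * Complex.cot (Real.pi * z) - 1 / z) := by
  have hs : Summable (fun n : ℕ+ => 1 / (z - (n : ℂ)) + 1 / (z + (n : ℂ))) := by
    rw [← Equiv.pnatEquivNat.symm.summable_iff]
    refine (summable_cotTerm hz).congr fun n => ?_
    simp [cotTerm, Equiv.pnatEquivNat]
  have h := hs.hasSum
  rw [show ∑' n : ℕ+, (1 / (z - (n : ℂ)) + 1 / (z + (n : ℂ))) =
    Real.pi * Complex.cot (Real.pi * z) - 1 / z by rw [cot_series_rep hz]; ring] at h
  convert h using 2 with n
  have h1 : z - (n : ℂ) ≠ 0 := fun h0 => hz ⟨n, by simpa using (sub_eq_zero.mp h0).symm⟩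
  have h2 : z + (n : ℂ) ≠ 0 := fun h0 => hz ⟨-n, by
    simpa using (eq_neg_of_add_eq_zero_left h0).symm⟩
  rw [sq_sub_sq]
  field_simp
  ring

lemma hasSum_cot {x : ℝ} (hx : 0 < x) (hn : ∀ m : ℕ+, x ≠ m) :
    HasSum (fun n : ℕ+ => 2 * x / (x ^ 2 - (n : ℝ) ^ 2))
      (Real.pi * Real.cot (Real.pi * x) - 1 / x) := by
  have hz : (x : ℂ) ∈ Complex.integerComplement := by
    rw [Complex.mem_integerComplement_iff]
    rintro ⟨n, h⟩
    have h' : (n : ℝ) = x := by exact_mod_cast h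
    have hpos : 0 < n := by
      have : (0 : ℝ) < n := h' ▸ hx
      exact_mod_cast this
    refine hn ⟨n.toNat, by omega⟩ ?_
    rw [← h']
    have : ((n.toNat : ℤ) : ℝ) = n := by rw [Int.toNat_of_nonneg hpos.le]
    change (n : ℝ) = ((n.toNat : ℕ) : ℝ)
    rw [← Int.cast_natCast, this]
  have h := hasSum_complex_cot hz
  rw [← Complex.hasSum_ofReal]
  convert h using 1
  · ext n; push_cast; rfl
  · push_cast [Complex.ofReal_cot]; rfl

/-- Substitute $z=ix$ in the cotangent expansion and multiply by $i$. -/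
lemma hasSum_coth {x : ℝ} (hx : 0 < x) :
    HasSum (fun n : ℕ+ => 2 * x / (x ^ 2 + (n : ℝ) ^ 2))
      (Real.pi * (Real.cosh (Real.pi * x) / Real.sinh (Real.pi * x)) - 1 / x) := by
  have hz : (x * Complex.I : ℂ) ∈ Complex.integerComplement := by
    rw [Complex.mem_integerComplement_iff]
    rintro ⟨n, h⟩
    have := congrArg Complex.im h
    simp at this
    exact hx.ne this
  have h := (hasSum_complex_cot hz).mul_left Complex.I
  rw [← Complex.hasSum_ofReal]
  have hx' : (x : ℂ) ≠ 0 := by exact_mod_cast hx.ne'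
  have hsh : Complex.sinh (Real.pi * x) ≠ 0 := by
    rw [← Complex.ofReal_mul, ← Complex.ofReal_sinh]
    exact_mod_cast (Real.sinh_pos_iff.mpr (by positivity)).ne'
  have hval : Complex.I * (Real.pi * Complex.cot (Real.pi * (x * Complex.I)) -
      1 / (x * Complex.I)) =
      ((Real.pi * (Real.cosh (Real.pi * x) / Real.sinh (Real.pi * x)) - 1 / x : ℝ) : ℂ) := by
    push_cast
    rw [Complex.cot_eq_cos_div_sin, ← mul_assoc, Complex.cos_mul_I, Complex.sin_mul_I]
    field_simp
  rw [hval] at h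
  refine h.congr_terms fun n => ?_
  have h1 : (x : ℂ) ^ 2 + (n : ℂ) ^ 2 ≠ 0 := by
    have : x ^ 2 + (n : ℝ) ^ 2 ≠ 0 := by positivity
    exact_mod_cast this
  have h2 : (x * Complex.I : ℂ) ^ 2 - (n : ℂ) ^ 2 ≠ 0 := by
    rw [mul_pow, Complex.I_sq]
    intro h0
    exact h1 (by linear_combination -h0)
  push_cast
  rw [← mul_div_assoc, div_eq_div_iff h1 h2]
  linear_combination (2 * (x : ℂ) ^ 3 - 2 * x * (x ^ 2 + (n : ℂ) ^ 2)) * Complex.I_sq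

/-- The hyperbolic cotangent. -/
noncomputable def coth (x : ℝ) : ℝ := Real.cosh x / Real.sinh x

lemma sinh_pi_pos {x : ℝ} (hx : 0 < x) : 0 < Real.sinh (Real.pi * x) :=
  Real.sinh_pos_iff.mpr (by positivity)

lemma summable_inv_sq : Summable (fun n : ℕ+ => 1 / (n : ℝ) ^ 2) := by
  have := (Real.summable_one_div_nat_pow (p := 2)).mpr (by norm_num)
  exact this.comp_injective PNat.coe_injective

lemma hasSum_inv_sq : HasSum (fun n : ℕ+ => 1 / (n : ℝ) ^ 2) (Real.pi ^ 2 / 6) := by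
  have h := hasSum_zeta_two.tsum_eq
  rw [← tsum_zero_pnat_eq_tsum_nat hasSum_zeta_two.summable] at h
  have h2 := summable_inv_sq.hasSum
  simp only [Nat.cast_zero, ne_eq, OfNat.ofNat_ne_zero, not_false_eq_true, zero_pow, div_zero,
    zero_add] at h
  rwa [h] at h2

/-- Expansion of the squared hyperbolic cosecant. -/
lemma hasSum_csch_sq {x : ℝ} (hx : 0 < x) :
    HasSum (fun n : ℕ+ => 2 * (x ^ 2 - (n : ℝ) ^ 2) / (x ^ 2 + (n : ℝ) ^ 2) ^ 2)
      (Real.pi ^ 2 / Real.sinh (Real.pi * x) ^ 2 - 1 / x ^ 2) := by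
  have hb : ∀ (n : ℕ+) (y : ℝ),
      ‖-(2 * (y ^ 2 - (n : ℝ) ^ 2) / (y ^ 2 + (n : ℝ) ^ 2) ^ 2)‖ ≤ 2 * (1 / (n : ℝ) ^ 2) := by
    intro n y
    have hn : (0 : ℝ) < n := by positivity
    rw [norm_neg, norm_div, Real.norm_eq_abs, Real.norm_eq_abs,
      abs_of_pos (a := (y ^ 2 + (n : ℝ) ^ 2) ^ 2) (by positivity), abs_mul, abs_two,
      mul_one_div, div_le_div_iff₀ (by positivity) (by positivity)]
    have h1 : |y ^ 2 - (n : ℝ) ^ 2| ≤ y ^ 2 + (n : ℝ) ^ 2 := by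
      rw [abs_le]; constructor <;> nlinarith [sq_nonneg y, sq_nonneg (n : ℝ)]
    have h2 : (n : ℝ) ^ 2 ≤ y ^ 2 + (n : ℝ) ^ 2 := by nlinarith [sq_nonneg y]
    calc 2 * |y ^ 2 - (n : ℝ) ^ 2| * (n : ℝ) ^ 2
        ≤ 2 * (y ^ 2 + (n : ℝ) ^ 2) * (y ^ 2 + (n : ℝ) ^ 2) := by gcongr
      _ = _ := by ring
  have hd : ∀ (n : ℕ+) (y : ℝ), HasDerivAt (fun y : ℝ => 2 * y / (y ^ 2 + (n : ℝ) ^ 2))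
      (-(2 * (y ^ 2 - (n : ℝ) ^ 2) / (y ^ 2 + (n : ℝ) ^ 2) ^ 2)) y := by
    intro n y
    have hn : (0 : ℝ) < n := by positivity
    have h0 : y ^ 2 + (n : ℝ) ^ 2 ≠ 0 := by positivity
    have h1 : HasDerivAt (fun y : ℝ => y ^ 2 + (n : ℝ) ^ 2) (2 * y) y := by
      simpa using ((hasDerivAt_id' y).fun_pow 2).add_const ((n : ℝ) ^ 2)
    refine (((hasDerivAt_id' y).const_mul 2).fun_div h1 h0).congr_deriv ?_
    rw [← neg_div]
    congr 1
    ring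
  -- The expansion of $\coth$ is differentiated term by term; the majorant $2/n^2$ holds on the
  -- whole line.
  have h1 : HasDerivAt (fun y : ℝ => ∑' n : ℕ+, 2 * y / (y ^ 2 + (n : ℝ) ^ 2))
      (∑' n : ℕ+, -(2 * (x ^ 2 - (n : ℝ) ^ 2) / (x ^ 2 + (n : ℝ) ^ 2) ^ 2)) x :=
    hasDerivAt_tsum (summable_inv_sq.mul_left 2) hd hb (y₀ := x) (hasSum_coth hx).summable x
  have hsh := sinh_pi_pos hx
  have h2 : HasDerivAt (fun y : ℝ => Real.pi * (Real.cosh (Real.pi * y) / Real.sinh (Real.pi * y))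
      - 1 / y) (-(Real.pi ^ 2 / Real.sinh (Real.pi * x) ^ 2 - 1 / x ^ 2)) x := by
    have e := (hasDerivAt_id x).const_mul Real.pi
    have := ((e.cosh.div e.sinh hsh.ne').const_mul Real.pi).sub (hasDerivAt_inv hx.ne')
    simp only [one_div]
    refine this.congr_deriv ?_
    simp only [id]
    have := Real.cosh_sq (Real.pi * x)
    field_simp
    rw [this]; ring
  have h3 := h1.unique (h2.congr_of_eventuallyEq (by
    filter_upwards [eventually_gt_nhds hx] with y hy using (hasSum_coth hy).tsum_eq))
  have hs : Summable (fun n : ℕ+ => 2 * (x ^ 2 - (n : ℝ) ^ 2) / (x ^ 2 + (n : ℝ) ^ 2) ^ 2) := by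
    refine Summable.of_norm_bounded (summable_inv_sq.mul_left 2) fun n => ?_
    rw [← norm_neg]; exact hb n x
  have h4 := hs.hasSum
  rw [tsum_neg, neg_inj] at h3
  rwa [h3] at h4

lemma summable_inv_sq_mul_inv_sq :
    Summable (fun p : ℕ+ × ℕ+ => 1 / ((p.1 : ℝ) ^ 2 * (p.2 : ℝ) ^ 2)) := by
  refine (summable_inv_sq.mul_of_nonneg summable_inv_sq (fun _ => by positivity)
    (fun _ => by positivity)).congr fun p => ?_
  rw [div_mul_div_comm, one_mul]

/-- Interchange of a double sum dominated by `C / (n² m²)`. -/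
lemma hasSum_comm_of_le {g : ℕ+ → ℕ+ → ℝ} {C : ℝ}
    (hg : ∀ n m, |g n m| ≤ C * (1 / ((n : ℝ) ^ 2 * (m : ℝ) ^ 2))) {r c : ℕ+ → ℝ}
    (hr : ∀ n, HasSum (fun m => g n m) (r n)) (hc : ∀ m, HasSum (fun n => g n m) (c m)) :
    ∃ s, HasSum r s ∧ HasSum c s := by
  have hs : Summable (fun p : ℕ+ × ℕ+ => g p.1 p.2) :=
    Summable.of_norm_bounded (summable_inv_sq_mul_inv_sq.mul_left C) fun p => hg p.1 p.2
  refine ⟨_, hs.hasSum.prod_fiberwise hr, ?_⟩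
  have h2 := (Equiv.prodComm ℕ+ ℕ+).hasSum_iff.mpr hs.hasSum
  exact h2.prod_fiberwise hc

/-! ### Partial fractions of products -/

section PartialFractions

variable {x : ℝ}

lemma sq_sub_sq_ne_zero (hx : 0 < x) (hn : ∀ m : ℕ+, x ≠ m) (n : ℕ+) :
    x ^ 2 - (n : ℝ) ^ 2 ≠ 0 := by
  rw [sq_sub_sq]
  exact mul_ne_zero (by positivity) (sub_ne_zero.mpr (hn n))

/-- Partial fractions of `cot (π x) coth (π x)`. -/
lemma hasSum_cot_mul_coth (hx : 0 < x) (hn : ∀ m : ℕ+, x ≠ m) :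
    HasSum (fun k : ℕ+ => 4 * x ^ 2 * (k * (Real.pi * coth (Real.pi * k))) /
        (x ^ 4 - (k : ℝ) ^ 4))
      (Real.pi ^ 2 * Real.cot (Real.pi * x) * coth (Real.pi * x) - 1 / x ^ 2) := by
  have hA := hasSum_cot hx hn
  have hB := hasSum_coth hx
  rw [← coth] at hB
  set A := Real.pi * Real.cot (Real.pi * x) - 1 / x with hAd
  set B := Real.pi * coth (Real.pi * x) - 1 / x with hBd
  -- the sums `∑ₘ 1 / (n² + m²)`
  set S : ℕ+ → ℝ := fun n => (Real.pi * coth (Real.pi * n) - 1 / n) / (2 * n) with hSd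
  have hS : ∀ n : ℕ+, HasSum (fun m : ℕ+ => 1 / ((n : ℝ) ^ 2 + (m : ℝ) ^ 2)) (S n) := by
    intro n
    have := (hasSum_coth (x := (n : ℝ)) (by positivity)).div_const (2 * (n : ℝ))
    rw [← coth] at this
    refine this.congr_terms fun m => ?_
    field_simp
  -- The array is the difference quotient $\bigl(\frac1{n^2+m^2}-\frac1{x^2+m^2}\bigr)/(x^2-n^2)$.
  -- Its row sums bring in the product of the two expansions, its column sums are single terms, and
  -- the unknown common total $s$ cancels below.
  obtain ⟨s, hs1, hs2⟩ := hasSum_comm_of_le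
    (g := fun n m : ℕ+ => 1 / (((n : ℝ) ^ 2 + (m : ℝ) ^ 2) * (x ^ 2 + (m : ℝ) ^ 2))) (C := 1)
    (r := fun n => B / (2 * x) * (1 / (x ^ 2 - (n : ℝ) ^ 2)) * (-1) +
      S n * (1 / (x ^ 2 - (n : ℝ) ^ 2)))
    (c := fun m => S m * (1 / (x ^ 2 + (m : ℝ) ^ 2)))
    (by
      intro n m
      rw [abs_of_pos (by positivity), one_mul]
      gcongr
      · linarith [sq_nonneg (m : ℝ)]
      · linarith [sq_nonneg x])
    (by
      intro n
      have h0 := sq_sub_sq_ne_zero hx hn n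
      have h1 := (hS n).mul_right (1 / (x ^ 2 - (n : ℝ) ^ 2))
      have h2 := ((hB.div_const (2 * x)).mul_right (1 / (x ^ 2 - (n : ℝ) ^ 2))).mul_right (-1)
      refine (h2.add h1).congr_terms fun m => ?_
      field_simp
      ring)
    (by
      intro m
      refine ((hS m).mul_right (1 / (x ^ 2 + (m : ℝ) ^ 2))).congr_terms fun n => ?_
      rw [div_mul_div_comm, one_mul, add_comm ((m : ℝ) ^ 2)])
  have h3 := ((hA.div_const (2 * x)).mul_left (B / (2 * x))).mul_right (-1)
  have h4 := ((hs1.sub h3).sub hs2).mul_left (4 * x ^ 2)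
  -- These multiples of the two expansions absorb the summand $-1/n$ inside `S`.
  have h5 := h4.add ((hA.div_const x).add (hB.div_const x))
  have hval : 4 * x ^ 2 * (s - B / (2 * x) * (A / (2 * x)) * -1 - s) + (A / x + B / x) =
      Real.pi ^ 2 * Real.cot (Real.pi * x) * coth (Real.pi * x) - 1 / x ^ 2 := by
    rw [hAd, hBd]; field_simp; ring
  rw [hval] at h5
  refine h5.congr_terms fun k => ?_
  have h0 := sq_sub_sq_ne_zero hx hn k
  have h6 : x ^ 4 - (k : ℝ) ^ 4 = (x ^ 2 - (k : ℝ) ^ 2) * (x ^ 2 + (k : ℝ) ^ 2) := by ring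
  rw [h6, hSd]
  field_simp
  ring

/-- Partial fractions of `cot (π x) / sinh² (π x)`. -/
lemma hasSum_cot_mul_csch_sq (hx : 0 < x) (hn : ∀ m : ℕ+, x ≠ m) :
    HasSum (fun k : ℕ+ =>
        4 * Real.pi * k * x * coth (Real.pi * k) / ((k : ℝ) ^ 2 + x ^ 2) ^ 2 +
        4 * x ^ 3 * (Real.pi ^ 2 / Real.sinh (Real.pi * k) ^ 2) / ((x : ℝ) ^ 4 - (k : ℝ) ^ 4))
      (Real.pi ^ 3 * Real.cot (Real.pi * x) / Real.sinh (Real.pi * x) ^ 2 - 1 / x ^ 3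
        + 2 * Real.pi ^ 2 / (3 * x)) := by
  have hA := hasSum_cot hx hn
  have hF := hasSum_csch_sq hx
  set A := Real.pi * Real.cot (Real.pi * x) - 1 / x with hAd
  set F := Real.pi ^ 2 / Real.sinh (Real.pi * x) ^ 2 - 1 / x ^ 2 with hFd
  set S : ℕ+ → ℝ := fun n => (Real.pi * coth (Real.pi * n) - 1 / n) / (2 * n) with hSd
  set T : ℕ+ → ℝ := fun n => Real.pi ^ 2 / Real.sinh (Real.pi * n) ^ 2 - 1 / (n : ℝ) ^ 2 with hTd
  have hS : ∀ n : ℕ+, HasSum (fun m : ℕ+ => 1 / ((n : ℝ) ^ 2 + (m : ℝ) ^ 2)) (S n) := by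
    intro n
    have := (hasSum_coth (x := (n : ℝ)) (by positivity)).div_const (2 * (n : ℝ))
    rw [← coth] at this
    refine this.congr_terms fun m => ?_
    field_simp
  have hT : ∀ n : ℕ+, HasSum (fun m : ℕ+ =>
      2 * ((n : ℝ) ^ 2 - (m : ℝ) ^ 2) / ((n : ℝ) ^ 2 + (m : ℝ) ^ 2) ^ 2) (T n) :=
    fun n => hasSum_csch_sq (by positivity)
  -- With $f_m(y)=2(y^2-m^2)/(y^2+m^2)^2$, the array is $(f_m(x)-f_m(n))/(x^2-n^2)$ written without
  -- a denominator that can vanish. The constant 6 is 4 + 2, one bound for each summand.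
  obtain ⟨s, hs1, hs2⟩ := hasSum_comm_of_le
    (g := fun n m : ℕ+ => 4 * (m : ℝ) ^ 2 / (x ^ 2 + (m : ℝ) ^ 2) ^ 2 *
        (1 / ((m : ℝ) ^ 2 + (n : ℝ) ^ 2)) +
      1 / (x ^ 2 + (m : ℝ) ^ 2) *
        (2 * ((m : ℝ) ^ 2 - (n : ℝ) ^ 2) / ((m : ℝ) ^ 2 + (n : ℝ) ^ 2) ^ 2)) (C := 6)
    (r := fun n => F * (1 / (x ^ 2 - (n : ℝ) ^ 2)) - T n * (1 / (x ^ 2 - (n : ℝ) ^ 2)))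
    (c := fun m => 4 * (m : ℝ) ^ 2 / (x ^ 2 + (m : ℝ) ^ 2) ^ 2 * S m +
      1 / (x ^ 2 + (m : ℝ) ^ 2) * T m)
    (by
      intro n m
      have hx2 := sq_nonneg x
      have hm2 : 0 < (m : ℝ) ^ 2 := by positivity
      have hn2 : 0 < (n : ℝ) ^ 2 := by positivity
      have e1 : |4 * (m : ℝ) ^ 2 / (x ^ 2 + (m : ℝ) ^ 2) ^ 2 * (1 / ((m : ℝ) ^ 2 + (n : ℝ) ^ 2))|
          ≤ 4 * (1 / ((n : ℝ) ^ 2 * (m : ℝ) ^ 2)) := by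
        rw [abs_of_pos (by positivity), div_mul_div_comm, mul_one, mul_one_div]
        rw [div_le_div_iff₀ (by positivity) (by positivity)]
        have : (m : ℝ) ^ 2 * (m : ℝ) ^ 2 * (n : ℝ) ^ 2 ≤
            (x ^ 2 + (m : ℝ) ^ 2) * (x ^ 2 + (m : ℝ) ^ 2) * ((m : ℝ) ^ 2 + (n : ℝ) ^ 2) := by
          gcongr <;> linarith
        linarith
      have e2 : |1 / (x ^ 2 + (m : ℝ) ^ 2) *
          (2 * ((m : ℝ) ^ 2 - (n : ℝ) ^ 2) / ((m : ℝ) ^ 2 + (n : ℝ) ^ 2) ^ 2)|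
          ≤ 2 * (1 / ((n : ℝ) ^ 2 * (m : ℝ) ^ 2)) := by
        rw [abs_mul, abs_div, abs_div, abs_mul, abs_one, abs_two,
          abs_of_pos (a := x ^ 2 + (m : ℝ) ^ 2) (by positivity),
          abs_of_pos (a := ((m : ℝ) ^ 2 + (n : ℝ) ^ 2) ^ 2) (by positivity),
          div_mul_div_comm, one_mul, mul_one_div, div_le_div_iff₀ (by positivity) (by positivity)]
        have h1 : |(m : ℝ) ^ 2 - (n : ℝ) ^ 2| ≤ (m : ℝ) ^ 2 + (n : ℝ) ^ 2 := by
          rw [abs_le]; constructor <;> linarith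
        have : (m : ℝ) ^ 2 * (|(m : ℝ) ^ 2 - (n : ℝ) ^ 2| * (n : ℝ) ^ 2) ≤
            (x ^ 2 + (m : ℝ) ^ 2) *
              (((m : ℝ) ^ 2 + (n : ℝ) ^ 2) * ((m : ℝ) ^ 2 + (n : ℝ) ^ 2)) := by
          gcongr <;> linarith
        linarith
      calc _ ≤ _ := abs_add_le _ _
        _ ≤ _ := add_le_add e1 e2
        _ = _ := by ring)
    (by
      intro n
      have h0 := sq_sub_sq_ne_zero hx hn n
      have h1 := (hT n).mul_right (1 / (x ^ 2 - (n : ℝ) ^ 2))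
      have h2 := hF.mul_right (1 / (x ^ 2 - (n : ℝ) ^ 2))
      refine (h2.sub h1).congr_terms fun m => ?_
      field_simp
      ring)
    (by
      intro m
      exact ((hS m).mul_left _).add ((hT m).mul_left _))
  have h3 := (hA.div_const (2 * x)).mul_left F
  have h4 := ((h3.sub hs1).add hs2).mul_left (2 * x)
  -- The rational parts of `S` and `T` are absorbed here. The multiple of $\zeta(2)$ is the source
  -- of $2\pi^2/(3x)$, hence of $\frac\pi3\log x$ in the formula.
  have h5 := h4.add (((hA.div_const (x ^ 2)).add (hF.div_const x)).add
    (hasSum_inv_sq.mul_left (4 / x)))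
  have hval : 2 * x * (F * (A / (2 * x)) - s + s) +
      (A / x ^ 2 + F / x + 4 / x * (Real.pi ^ 2 / 6)) =
      Real.pi ^ 3 * Real.cot (Real.pi * x) / Real.sinh (Real.pi * x) ^ 2 - 1 / x ^ 3
        + 2 * Real.pi ^ 2 / (3 * x) := by
    have := sinh_pi_pos hx
    rw [hAd, hFd]; field_simp; ring
  rw [hval] at h5
  refine h5.congr_terms fun k => ?_
  have h0 := sq_sub_sq_ne_zero hx hn k
  have h6 : x ^ 4 - (k : ℝ) ^ 4 = (x ^ 2 - (k : ℝ) ^ 2) * (x ^ 2 + (k : ℝ) ^ 2) := by ring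
  have := sinh_pi_pos (x := (k : ℝ)) (by positivity)
  rw [h6, hSd, hTd]
  simp only
  generalize coth (Real.pi * k) = c
  generalize hh : Real.pi ^ 2 / Real.sinh (Real.pi * k) ^ 2 = q
  field_simp
  ring

end PartialFractions

/-! ### Uniform estimates and absolute convergence -/

lemma exists_ball_dist_pnat (x : ℝ) :
    ∃ δ > 0, ∀ k : ℕ+, (k : ℝ) ≠ x → ∀ y ∈ Metric.ball x δ, δ ≤ |(k : ℝ) - y| := by
  -- The naturals other than $x$ form a closed set. This gives one $\delta$ for all $k$ and all $y$
  -- near $x$, also when $x$ is itself an integer.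
  have hc : IsClosed ((fun n : ℕ => (n : ℝ)) '' {n : ℕ | (n : ℝ) ≠ x}) :=
    Nat.isClosedEmbedding_coe_real.isClosedMap _ (isClosed_discrete _)
  have hx : x ∉ (fun n : ℕ => (n : ℝ)) '' {n : ℕ | (n : ℝ) ≠ x} := by
    rintro ⟨n, hn, h⟩; exact hn h
  obtain ⟨ε, hε, h⟩ := Metric.isOpen_iff.mp hc.isOpen_compl x hx
  refine ⟨ε / 2, by positivity, fun k hk y hy => ?_⟩
  by_contra hlt
  push Not at hlt
  have h1 : (k : ℝ) ∈ Metric.ball x ε := by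
    rw [Metric.mem_ball, Real.dist_eq] at hy ⊢
    calc |(k : ℝ) - x| = |((k : ℝ) - y) + (y - x)| := by ring_nf
      _ ≤ |(k : ℝ) - y| + |y - x| := abs_add_le _ _
      _ < ε := by linarith
  exact h h1 ⟨(k : ℕ), hk, rfl⟩

lemma summable_pow_mul_exp_neg (p : ℕ) :
    Summable (fun k : ℕ+ => (k : ℝ) ^ p * Real.exp (-(k : ℝ))) := by
  have := (Real.summable_pow_mul_exp_neg_nat_mul p one_pos).comp_injective PNat.coe_injective
  simpa [Function.comp_def] using this

lemma two_mul_pi_mul_ge (k : ℕ+) : (k : ℝ) + 1 ≤ 2 * Real.pi * k := by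
  have h1 : (1 : ℝ) ≤ k := by exact_mod_cast k.pos
  nlinarith [Real.pi_gt_three]

lemma two_le_exp {u : ℝ} (hu : 1 ≤ u) : 2 ≤ Real.exp u := by
  linarith [Real.add_one_le_exp u]

lemma exp_two_pi_sub_one_ge (k : ℕ+) :
    Real.exp k / 2 ≤ Real.exp (2 * Real.pi * k) - 1 := by
  have h1 : Real.exp k * 2 ≤ Real.exp (2 * Real.pi * k) := by
    calc Real.exp k * 2 ≤ Real.exp k * Real.exp 1 := by
          gcongr; exact two_le_exp le_rfl
      _ = Real.exp ((k : ℝ) + 1) := (Real.exp_add _ _).symm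
      _ ≤ _ := Real.exp_le_exp.mpr (two_mul_pi_mul_ge k)
  have h2 : 1 ≤ Real.exp (k : ℝ) := Real.one_le_exp (by positivity)
  linarith

lemma exp_two_pi_sub_one_pos (k : ℕ+) : 0 < Real.exp (2 * Real.pi * k) - 1 :=
  lt_of_lt_of_le (by positivity) (exp_two_pi_sub_one_ge k)

lemma inv_exp_sub_one_le (k : ℕ+) :
    1 / (Real.exp (2 * Real.pi * k) - 1) ≤ 2 * Real.exp (-(k : ℝ)) := by
  rw [div_le_iff₀ (exp_two_pi_sub_one_pos k)]
  calc (1 : ℝ) = 2 * Real.exp (-(k : ℝ)) * (Real.exp k / 2) := by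
        rw [mul_div_assoc', mul_assoc, ← Real.exp_add]; simp
    _ ≤ _ := by gcongr; exact exp_two_pi_sub_one_ge k

lemma exp_div_four_le_sinh {u : ℝ} (hu : 1 ≤ u) : Real.exp u / 4 ≤ Real.sinh u := by
  rw [Real.sinh_eq, Real.exp_neg]
  have h := two_le_exp hu
  have h2 : (Real.exp u)⁻¹ ≤ Real.exp u / 2 := by
    rw [inv_le_iff_one_le_mul₀ (by positivity)]
    nlinarith
  linarith

lemma inv_sinh_sq_le (k : ℕ+) :
    1 / Real.sinh (Real.pi * k) ^ 2 ≤ 16 * Real.exp (-(k : ℝ)) := by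
  have h1 : (1 : ℝ) ≤ k := by exact_mod_cast k.pos
  have h2 : (1 : ℝ) ≤ Real.pi * k := by nlinarith [Real.pi_gt_three]
  have h3 := exp_div_four_le_sinh h2
  have h4 := sinh_pi_pos (x := (k : ℝ)) (by positivity)
  rw [div_le_iff₀ (by positivity)]
  calc (1 : ℝ) = 16 * Real.exp (-(k : ℝ)) * (Real.exp k / 16) := by
        rw [show 16 * Real.exp (-(k : ℝ)) * (Real.exp k / 16) =
          Real.exp (-(k : ℝ)) * Real.exp k by ring, ← Real.exp_add]; simp
    _ ≤ 16 * Real.exp (-(k : ℝ)) * (Real.exp (Real.pi * k) / 4) ^ 2 := by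
        gcongr
        rw [div_pow, ← Real.exp_nat_mul]
        have : (k : ℝ) ≤ (2 : ℕ) * (Real.pi * k) := by push_cast; linarith [two_mul_pi_mul_ge k]
        have := Real.exp_le_exp.mpr this
        rw [show (4 : ℝ) ^ 2 = 16 by norm_num]
        gcongr
    _ ≤ _ := by gcongr

lemma summable_ratTerm (x : ℝ) : Summable (ratTerm x) := by
  refine Summable.of_nonneg_of_le (fun k => by unfold ratTerm; positivity) (fun k => ?_)
    (summable_inv_sq.mul_left (x ^ 2))
  have h1 : (1 : ℝ) ≤ k := by exact_mod_cast k.pos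
  unfold ratTerm
  rw [mul_one_div]
  gcongr
  calc (k : ℝ) ^ 2 ≤ 1 * ((k : ℝ) ^ 2 + x ^ 2) := by linarith [sq_nonneg x]
    _ ≤ _ := by gcongr

lemma abs_expPlusTerm_le (x : ℝ) (k : ℕ+) :
    |expPlusTerm x k| ≤ 4 * ((k : ℝ) ^ 1 * Real.exp (-(k : ℝ))) := by
  have h1 : (1 : ℝ) ≤ k := by exact_mod_cast k.pos
  have h2 := exp_two_pi_sub_one_pos k
  unfold expPlusTerm
  rw [abs_of_pos (by positivity)]
  calc 2 * (k : ℝ) / (((k : ℝ) ^ 2 + x ^ 2) * (Real.exp (2 * Real.pi * k) - 1))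
      = 2 * (k : ℝ) / ((k : ℝ) ^ 2 + x ^ 2) * (1 / (Real.exp (2 * Real.pi * k) - 1)) := by
        field_simp
    _ ≤ 2 * (k : ℝ) / 1 * (2 * Real.exp (-(k : ℝ))) := by
        gcongr
        · nlinarith [sq_nonneg x]
        · exact inv_exp_sub_one_le k
    _ = _ := by ring

lemma summable_expPlusTerm (x : ℝ) : Summable (expPlusTerm x) :=
  Summable.of_norm_bounded ((summable_pow_mul_exp_neg 1).mul_left 4) (abs_expPlusTerm_le x)

lemma summable_expMinusTerm {x : ℝ} (hx : 0 < x) : Summable (expMinusTerm x) := by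
  obtain ⟨δ, hδ, h⟩ := exists_ball_dist_pnat x
  refine Summable.of_norm_bounded ((summable_pow_mul_exp_neg 0).mul_left (4 / δ)) fun k => ?_
  have h2 := exp_two_pi_sub_one_pos k
  unfold expMinusTerm
  -- At an integer $x$ the term $k=x$ is a division by zero, with value 0.
  by_cases hk : (k : ℝ) = x
  · rw [hk]; simp; positivity
  have h3 := h k hk x (Metric.mem_ball_self hδ)
  have h4 : δ * k ≤ |(k : ℝ) ^ 2 - x ^ 2| := by
    rw [sq_sub_sq, abs_mul, abs_of_pos (a := (k : ℝ) + x) (by positivity), mul_comm δ]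
    gcongr
    linarith
  rw [Real.norm_eq_abs, abs_div, abs_mul (Real.exp _ - 1), abs_of_pos h2,
    abs_of_pos (a := 2 * (k : ℝ)) (by positivity)]
  calc 2 * (k : ℝ) / ((Real.exp (2 * Real.pi * k) - 1) * |(k : ℝ) ^ 2 - x ^ 2|)
      ≤ 2 * (k : ℝ) / ((Real.exp (2 * Real.pi * k) - 1) * (δ * k)) := by gcongr
    _ = 2 / δ * (1 / (Real.exp (2 * Real.pi * k) - 1)) := by field_simp
    _ ≤ 2 / δ * (2 * Real.exp (-(k : ℝ))) := by gcongr; exact inv_exp_sub_one_le k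
    _ = _ := by ring

/-! ### The series for the digamma function -/

section Psi

lemma differentiableAt_Gamma_of_pos {x : ℝ} (hx : 0 < x) : DifferentiableAt ℝ Real.Gamma x :=
  Real.differentiableAt_Gamma fun m => ne_of_gt (by
    have : (0 : ℝ) ≤ m := m.cast_nonneg
    linarith)

lemma psi_add_one {x : ℝ} (hx : 0 < x) : psi (x + 1) = psi x + 1 / x := by
  have h1 : deriv Real.Gamma (x + 1) = Real.Gamma x + x * deriv Real.Gamma x := by
    rw [← deriv_comp_add_const]
    have : (fun y : ℝ => Real.Gamma (y + 1)) =ᶠ[𝓝 x] fun y => y * Real.Gamma y := by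
      filter_upwards [eventually_gt_nhds hx] with y hy using Real.Gamma_add_one hy.ne'
    rw [this.deriv_eq, deriv_fun_mul differentiableAt_fun_id (differentiableAt_Gamma_of_pos hx)]
    simp
  have hG := (Real.Gamma_pos_of_pos hx).ne'
  rw [psi, psi, h1, Real.Gamma_add_one hx.ne']
  field_simp
  ring

/-- On the positive axis $\psi$ is the derivative of the convex function $\log\Gamma$. -/
lemma psi_monotoneOn : MonotoneOn psi (Set.Ioi 0) := by
  have hd : ∀ x ∈ Set.Ioi (0 : ℝ), DifferentiableAt ℝ (Real.log ∘ Real.Gamma) x := fun x hx =>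
    (differentiableAt_Gamma_of_pos hx).log (Real.Gamma_pos_of_pos hx).ne'
  refine (Real.convexOn_log_Gamma.monotoneOn_deriv hd).congr fun x hx => ?_
  exact deriv.log (differentiableAt_Gamma_of_pos hx) (Real.Gamma_pos_of_pos hx).ne'

lemma psi_nat_add_one (n : ℕ) :
    psi (n + 1) = -Real.eulerMascheroniConstant + (harmonic n : ℝ) := by
  rw [psi, Real.deriv_Gamma_nat, Real.Gamma_nat_eq_factorial]
  exact mul_div_cancel_left₀ _ (by exact_mod_cast n.factorial_ne_zero)

lemma harmonic_add_le (n c : ℕ) :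
    (harmonic (n + c) : ℝ) ≤ harmonic n + c * (1 / ((n : ℝ) + 1)) := by
  induction c with
  | zero => simp
  | succ c ih =>
    rw [← add_assoc, harmonic_succ]
    push_cast
    have : ((n : ℝ) + c + 1)⁻¹ ≤ 1 / ((n : ℝ) + 1) := by
      rw [← one_div]; gcongr; linarith [(Nat.cast_nonneg c : (0 : ℝ) ≤ c)]
    linarith

/-- With a natural number $c\ge x$, monotonicity places $\psi(x+n+1)$ between $\psi(n+1)=H_n-\gamma$
and $\psi(n+c+1)=H_{n+c}-\gamma$, and $H_{n+c}-H_n\le c/(n+1)$. -/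
lemma tendsto_harmonic_sub_psi {x : ℝ} (hx : 0 < x) :
    Tendsto (fun n : ℕ => (harmonic n : ℝ) - psi (x + n + 1)) atTop
      (𝓝 Real.eulerMascheroniConstant) := by
  obtain ⟨c, hc⟩ := exists_nat_ge x
  have h1 : Tendsto (fun n : ℕ => Real.eulerMascheroniConstant - c * (1 / ((n : ℝ) + 1))) atTop
      (𝓝 Real.eulerMascheroniConstant) := by
    simpa using (tendsto_one_div_add_atTop_nhds_zero_nat.const_mul (c : ℝ)).const_sub
      Real.eulerMascheroniConstant
  refine tendsto_of_tendsto_of_tendsto_of_le_of_le h1 tendsto_const_nhds (fun n => ?_) fun n => ?_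
  · have h2 : psi (x + n + 1) ≤ psi ((n + c : ℕ) + 1) :=
      psi_monotoneOn (Set.mem_Ioi.mpr (by positivity)) (Set.mem_Ioi.mpr (by positivity))
        (by push_cast; linarith)
    rw [psi_nat_add_one] at h2
    have := harmonic_add_le n c
    simp only
    linarith
  · have h2 : psi (n + 1) ≤ psi (x + n + 1) :=
      psi_monotoneOn (Set.mem_Ioi.mpr (by positivity)) (Set.mem_Ioi.mpr (by positivity))
        (by linarith)
    rw [psi_nat_add_one] at h2
    simp only
    linarith

lemma psi_add_nat_add_one {x : ℝ} (hx : 0 < x) (n : ℕ) :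
    psi (x + n + 1) = psi (x + 1) + ∑ i ∈ Finset.range n, 1 / (((i : ℝ) + 1) + x) := by
  induction n with
  | zero => simp
  | succ n ih =>
    rw [Finset.sum_range_succ, ← add_assoc, ← ih]
    push_cast
    rw [← add_assoc, psi_add_one (x := x + n + 1) (by positivity)]
    congr 2
    ring

/-- The recurrence $\psi(y+1)=\psi(y)+1/y$ turns the partial sums into $H_n-\psi(x+n+1)+\psi(x+1)$.
Since the terms are nonnegative, their limit is the unconditional sum. -/
lemma hasSum_psi {x : ℝ} (hx : 0 < x) :
    HasSum (fun k : ℕ+ => 1 / (k : ℝ) - 1 / ((k : ℝ) + x))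
      (psi (x + 1) + Real.eulerMascheroniConstant) := by
  rw [hasSum_pnat_iff_hasSum_succ (f := fun n : ℕ => 1 / (n : ℝ) - 1 / ((n : ℝ) + x)),
    hasSum_iff_tendsto_nat_of_nonneg]
  · have h := (tendsto_harmonic_sub_psi hx).const_add (psi (x + 1))
    refine h.congr fun n => ?_
    rw [psi_add_nat_add_one hx, Finset.sum_sub_distrib, harmonic]
    push_cast
    simp only [one_div]
    ring
  · intro n
    rw [sub_nonneg]
    gcongr
    linarith

end Psi

/-! ### Comparison of the two formulas -/

lemma exp_two_pi_gt_one {x : ℝ} (hx : 0 < x) : 0 < Real.exp (2 * Real.pi * x) - 1 := by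
  rw [sub_pos]
  exact Real.one_lt_exp_iff.mpr (by positivity)

lemma coth_eq {x : ℝ} (hx : 0 < x) :
    coth (Real.pi * x) = 1 + 2 / (Real.exp (2 * Real.pi * x) - 1) := by
  have h := exp_two_pi_gt_one hx
  have e : Real.exp (2 * Real.pi * x) = Real.exp (Real.pi * x) * Real.exp (Real.pi * x) := by
    rw [← Real.exp_add]; ring_nf
  have hs := sinh_pi_pos hx
  rw [coth, div_eq_iff hs.ne', Real.cosh_eq, Real.sinh_eq, Real.exp_neg]
  rw [e, ← sq] at h ⊢
  have h' := h.ne'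
  field_simp
  ring

/-- The errors of the two formulas agree. -/
lemma psi_sub_psiRHS {x : ℝ} (hx : 0 < x) (hn : ∀ m : ℕ+, x ≠ m) :
    psi (x + 1) - psiRHS x = -Real.eulerMascheroniConstant - gammaRHS x := by
  have h1 := ((((hasSum_psi hx).sub (summable_ratTerm x).hasSum).sub
    (summable_expMinusTerm hx).hasSum).add (summable_expPlusTerm x).hasSum)
  -- Writing $\coth(\pi k)=1+2/(e^{2\pi k}-1)$ splits the expansion of $\cot\coth$ into the
  -- exponential series and a rational series; half the cotangent expansion corrects the latter.
  have h2 := ((hasSum_cot_mul_coth hx hn).div_const (2 * Real.pi)).sub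
    ((hasSum_cot hx hn).div_const 2)
  have h3 := h1.unique (h2.congr_terms fun k => by
    have h0 := sq_sub_sq_ne_zero hx hn k
    have h0' : (k : ℝ) ^ 2 - x ^ 2 ≠ 0 := by
      rw [← neg_sub]; exact neg_ne_zero.mpr h0
    have h6 : x ^ 4 - (k : ℝ) ^ 4 = (x ^ 2 - (k : ℝ) ^ 2) * (x ^ 2 + (k : ℝ) ^ 2) := by ring
    have h7 := exp_two_pi_sub_one_pos k
    have h8 : (k : ℝ) ^ 2 - x ^ 2 = -(x ^ 2 - (k : ℝ) ^ 2) := by ring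
    have h9 : 1 / ((k : ℝ) + x) = (x - k) / (x ^ 2 - (k : ℝ) ^ 2) := by
      rw [div_eq_div_iff (by positivity) h0]; ring
    rw [ratTerm, expPlusTerm, expMinusTerm, h6, h8, h9, coth_eq (x := (k : ℝ)) (by positivity)]
    generalize Real.exp (2 * Real.pi * k) - 1 = E at *
    field_simp
    ring)
  rw [coth_eq hx] at h3
  have h7 := exp_two_pi_gt_one hx
  have h4 : 1 / (2 * x) - 1 / (2 * Real.pi * x ^ 2) +
      Real.pi * Real.cot (Real.pi * x) / (Real.exp (2 * Real.pi * x) - 1) =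
      (Real.pi ^ 2 * Real.cot (Real.pi * x) * (1 + 2 / (Real.exp (2 * Real.pi * x) - 1)) -
        1 / x ^ 2) / (2 * Real.pi) - (Real.pi * Real.cot (Real.pi * x) - 1 / x) / 2 := by
    field_simp
    ring
  have h5 : 1 / (4 * Real.pi * x ^ 2) = 1 / (2 * Real.pi * x ^ 2) / 2 := by field_simp; norm_num
  rw [← h4] at h3
  unfold psiRHS gammaRHS
  rw [h5]
  linear_combination h3

/-! ### The derivative of the Clausen function -/

section Clausen

/-- `r e^{2πiy}` -/
noncomputable def circ (r y : ℝ) : ℂ := r * Complex.exp (Complex.I * (2 * Real.pi * y : ℝ))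

lemma norm_circ {r : ℝ} (hr : 0 ≤ r) (y : ℝ) : ‖circ r y‖ = r := by
  rw [circ, norm_mul, mul_comm Complex.I, Complex.norm_exp_ofReal_mul_I, mul_one,
    Complex.norm_real, Real.norm_of_nonneg hr]

lemma circ_pow_re (r y : ℝ) (n : ℕ) :
    (circ r y ^ n).re = r ^ n * Real.cos (2 * Real.pi * n * y) := by
  rw [circ, mul_pow, ← Complex.exp_nat_mul, ← Complex.ofReal_pow, Complex.re_ofReal_mul,
    show (n : ℂ) * (Complex.I * (2 * Real.pi * y : ℝ)) = (2 * Real.pi * n * y : ℝ) * Complex.I by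
      push_cast; ring, Complex.exp_ofReal_mul_I_re]

/-- Real part of $-\log(1-z)=\sum z^n/n$ at $z=re^{2\pi iy}$. -/
lemma hasSum_cos_div {r : ℝ} (hr0 : 0 ≤ r) (hr1 : r < 1) (y : ℝ) :
    HasSum (fun n : ℕ+ => r ^ (n : ℕ) * Real.cos (2 * Real.pi * n * y) / n)
      (-Real.log ‖1 - circ r y‖) := by
  have h := Complex.hasSum_taylorSeries_neg_log (z := circ r y) (by rwa [norm_circ hr0])
  have h2 := (Complex.hasSum_re h)
  rw [Complex.neg_re, Complex.log_re] at h2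
  have h3 : HasSum (fun n : ℕ => r ^ n * Real.cos (2 * Real.pi * n * y) / n)
      (-Real.log ‖1 - circ r y‖) := by
    refine h2.congr_terms fun n => ?_
    rw [Complex.div_natCast_re, circ_pow_re]
  have := hasSum_pnat_iff (f := fun n : ℕ => r ^ n * Real.cos (2 * Real.pi * n * y) / n)
    (a := -Real.log ‖1 - circ r y‖)
  rw [this]
  simpa using h3

lemma norm_one_sub_circ_one (y : ℝ) : ‖1 - circ 1 y‖ = |2 * Real.sin (Real.pi * y)| := by
  rw [norm_sub_rev, circ, Complex.ofReal_one, one_mul, Complex.norm_exp_I_mul_ofReal_sub_one,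
    Real.norm_eq_abs]
  ring_nf

/-- The Clausen function. -/
noncomputable def clausen (x : ℝ) : ℝ := ∑' n : ℕ+, Real.sin (2 * Real.pi * n * x) / (n : ℝ) ^ 2

lemma hasDerivAt_sin_mul (c x : ℝ) : HasDerivAt (fun y => Real.sin (2 * Real.pi * c * y))
    (2 * Real.pi * c * Real.cos (2 * Real.pi * c * x)) x := by
  have := ((hasDerivAt_id' x).const_mul (2 * Real.pi * c)).sin
  rwa [mul_one, mul_comm (Real.cos _)] at this

lemma hasDerivAt_cos_mul (c x : ℝ) : HasDerivAt (fun y => Real.cos (2 * Real.pi * c * y))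
    (-(2 * Real.pi * c * Real.sin (2 * Real.pi * c * x))) x := by
  have := ((hasDerivAt_id' x).const_mul (2 * Real.pi * c)).cos
  rwa [mul_one, neg_mul, mul_comm (Real.sin _)] at this

lemma abs_sin_div_le (n : ℕ+) (x : ℝ) :
    |Real.sin (2 * Real.pi * n * x) / (n : ℝ) ^ 2| ≤ 1 / (n : ℝ) ^ 2 := by
  rw [abs_div, abs_of_pos (a := (n : ℝ) ^ 2) (by positivity)]
  gcongr
  exact Real.abs_sin_le_one _

lemma hasDerivAt_clausen_abel {r : ℝ} (hr0 : 0 ≤ r) (hr1 : r < 1) (x : ℝ) :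
    HasDerivAt (fun y => ∑' n : ℕ+, r ^ (n : ℕ) * (Real.sin (2 * Real.pi * n * y) / (n : ℝ) ^ 2))
      (-(2 * Real.pi * Real.log ‖1 - circ r x‖)) x := by
  have hs : Summable (fun n : ℕ+ => 2 * Real.pi * r ^ (n : ℕ)) :=
    ((summable_geometric_of_lt_one hr0 hr1).comp_injective PNat.coe_injective).mul_left _
  have h0 : Summable fun n : ℕ+ =>
      r ^ (n : ℕ) * (Real.sin (2 * Real.pi * n * x) / (n : ℝ) ^ 2) := by
    refine Summable.of_norm_bounded summable_inv_sq fun n => ?_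
    rw [norm_mul, Real.norm_eq_abs, Real.norm_eq_abs, abs_of_nonneg (by positivity)]
    calc _ ≤ 1 * (1 / (n : ℝ) ^ 2) :=
          mul_le_mul (pow_le_one₀ hr0 hr1.le) (abs_sin_div_le n x) (abs_nonneg _) zero_le_one
      _ = _ := one_mul _
  have h := hasDerivAt_tsum (g := fun (n : ℕ+) y =>
      r ^ (n : ℕ) * (Real.sin (2 * Real.pi * n * y) / (n : ℝ) ^ 2))
    (g' := fun (n : ℕ+) y => 2 * Real.pi * (r ^ (n : ℕ) * Real.cos (2 * Real.pi * n * y) / n))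
    hs (fun n y => by
      refine (((hasDerivAt_sin_mul n y).div_const ((n : ℝ) ^ 2)).const_mul
        (r ^ (n : ℕ))).congr_deriv ?_
      field_simp) (fun n y => by
      have hn : (1 : ℝ) ≤ n := by exact_mod_cast n.pos
      rw [Real.norm_eq_abs, abs_mul, abs_div, abs_mul (r ^ (n : ℕ)),
        abs_of_nonneg (a := 2 * Real.pi) (by positivity),
        abs_of_nonneg (a := r ^ (n : ℕ)) (by positivity),
        abs_of_nonneg (a := (n : ℝ)) (by positivity)]
      gcongr
      calc r ^ (n : ℕ) * |Real.cos (2 * Real.pi * n * y)| / n ≤ r ^ (n : ℕ) * 1 / 1 := by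
            gcongr
            exact Real.abs_cos_le_one _
        _ = _ := by ring) h0 x
  refine h.congr_deriv ?_
  rw [tsum_mul_left, (hasSum_cos_div hr0 hr1 x).tsum_eq]
  ring

/-- The differentiated series $\sum\cos(2\pi nx)/n$ has no summable majorant, so the factor $r^n$ is
inserted and $r\to1^-$. The derivatives of the damped series converge locally uniformly because
$\log|1-re^{2\pi iy}|$ is jointly continuous at $(1,x)$ when $\sin\pi x\ne0$. -/
lemma hasDerivAt_clausen {x : ℝ} (hx : Real.sin (Real.pi * x) ≠ 0) :
    HasDerivAt clausen (-(2 * Real.pi * Real.log |2 * Real.sin (Real.pi * x)|)) x := by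
  have hcirc : Continuous (fun p : ℝ × ℝ => circ p.1 p.2) := by unfold circ; fun_prop
  have hne : ‖1 - circ 1 x‖ ≠ 0 := by rw [norm_one_sub_circ_one]; simpa using hx
  have hG : ContinuousAt (fun p : ℝ × ℝ => -(2 * Real.pi * Real.log ‖1 - circ p.1 p.2‖))
      (1, x) := by
    have h1 : ContinuousAt (fun p : ℝ × ℝ => ‖1 - circ p.1 p.2‖) (1, x) := by fun_prop
    exact ((h1.log hne).const_mul _).neg
  have hr : ∀ᶠ r : ℝ in 𝓝[<] 1, 0 ≤ r ∧ r < 1 := by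
    filter_upwards [self_mem_nhdsWithin,
      mem_nhdsWithin_of_mem_nhds (lt_mem_nhds (zero_lt_one (α := ℝ)))] with r h1 h2
    exact ⟨le_of_lt h2, h1⟩
  rw [← norm_one_sub_circ_one]
  refine hasDerivAt_of_tendstoUniformlyOnFilter (l := 𝓝[<] (1 : ℝ))
    (f := fun r y => ∑' n : ℕ+, r ^ (n : ℕ) * (Real.sin (2 * Real.pi * n * y) / (n : ℝ) ^ 2))
    (f' := fun r y => -(2 * Real.pi * Real.log ‖1 - circ r y‖))
    (g' := fun y => -(2 * Real.pi * Real.log ‖1 - circ 1 y‖)) ?_ ?_ ?_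
  · rw [tendstoUniformlyOnFilter_iff_tendsto]
    refine Tendsto.mono_right ?_ (nhds_le_uniformity (-(2 * Real.pi * Real.log ‖1 - circ 1 x‖)))
    rw [nhds_prod_eq]
    have ha : Tendsto (fun q : ℝ × ℝ => ((1 : ℝ), q.2)) (𝓝[<] 1 ×ˢ 𝓝 x) (𝓝 (1, x)) := by
      rw [nhds_prod_eq]
      exact (tendsto_const_nhds).prodMk tendsto_snd
    have hb : Tendsto (fun q : ℝ × ℝ => (q.1, q.2)) (𝓝[<] 1 ×ˢ 𝓝 x) (𝓝 (1, x)) := by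
      rw [nhds_prod_eq]
      exact (tendsto_fst.mono_right nhdsWithin_le_nhds).prodMk tendsto_snd
    exact (hG.tendsto.comp ha).prodMk (hG.tendsto.comp hb)
  · filter_upwards [hr.prod_inl (𝓝 x)] with p hp
    exact hasDerivAt_clausen_abel hp.1 hp.2 p.2
  · refine Eventually.of_forall fun y => ?_
    refine tendsto_tsum_of_dominated_convergence summable_inv_sq (fun n => ?_) ?_
    · have : Tendsto (fun r : ℝ => r ^ (n : ℕ) * (Real.sin (2 * Real.pi * n * y) / (n : ℝ) ^ 2))
          (𝓝 1) (𝓝 (1 ^ (n : ℕ) * (Real.sin (2 * Real.pi * n * y) / (n : ℝ) ^ 2))) := by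
        apply Continuous.tendsto; fun_prop
      rw [one_pow, one_mul] at this
      exact this.mono_left nhdsWithin_le_nhds
    · filter_upwards [hr] with r hr n
      rw [norm_mul, Real.norm_eq_abs, Real.norm_eq_abs, abs_of_nonneg (pow_nonneg hr.1 _)]
      calc _ ≤ 1 * (1 / (n : ℝ) ^ 2) :=
            mul_le_mul (pow_le_one₀ hr.1 hr.2.le) (abs_sin_div_le n y) (abs_nonneg _) zero_le_one
        _ = _ := one_mul _

end Clausen

/-! ### The trigonometric double series -/

section Trig

/-- `∑ 1/n²` -/
noncomputable def invSqSum : ℝ := ∑' n : ℕ+, 1 / (n : ℝ) ^ 2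

lemma invSqSum_nonneg : 0 ≤ invSqSum := tsum_nonneg fun n => by positivity

lemma abs_sinTerm_le (x : ℝ) (k n : ℕ+) : |sinTerm x k n| ≤ 1 / (n : ℝ) ^ 2 := by
  unfold sinTerm
  rw [abs_div, abs_of_pos (a := (k : ℝ) ^ 2 + (n : ℝ) ^ 2) (by positivity)]
  gcongr
  · exact Real.abs_sin_le_one _
  · linarith [sq_nonneg (k : ℝ)]

lemma abs_cosTerm_le (x : ℝ) (k n : ℕ+) : |cosTerm x k n| ≤ 1 / (n : ℝ) ^ 2 := by
  have hn : (1 : ℝ) ≤ n := by exact_mod_cast n.pos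
  unfold cosTerm
  rw [abs_div, abs_of_pos (a := (n : ℝ) * ((k : ℝ) ^ 2 + (n : ℝ) ^ 2)) (by positivity)]
  gcongr
  · exact Real.abs_cos_le_one _
  · calc (n : ℝ) ^ 2 ≤ 1 * ((k : ℝ) ^ 2 + (n : ℝ) ^ 2) := by linarith [sq_nonneg (k : ℝ)]
      _ ≤ _ := by gcongr

lemma summable_sinTerm (x : ℝ) (k : ℕ+) : Summable (sinTerm x k) :=
  Summable.of_norm_bounded summable_inv_sq (abs_sinTerm_le x k)

lemma summable_cosTerm (x : ℝ) (k : ℕ+) : Summable (cosTerm x k) :=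
  Summable.of_norm_bounded summable_inv_sq (abs_cosTerm_le x k)

lemma hasDerivAt_tsum_cosTerm (k : ℕ+) (x : ℝ) :
    HasDerivAt (fun y => ∑' n, cosTerm y k n) (-(2 * Real.pi * ∑' n, sinTerm x k n)) x := by
  have h := hasDerivAt_tsum (g := fun n y => cosTerm y k n)
    (g' := fun n y => -(2 * Real.pi) * sinTerm y k n)
    (summable_inv_sq.mul_left (2 * Real.pi)) (fun n y => by
      refine ((hasDerivAt_cos_mul n y).div_const _).congr_deriv ?_
      unfold sinTerm
      field_simp) (fun n y => by
      rw [norm_mul, norm_neg, Real.norm_of_nonneg (by positivity)]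
      gcongr
      exact abs_sinTerm_le y k n) (summable_cosTerm x k) x
  rw [tsum_mul_left, neg_mul] at h
  exact h

/-- From $\frac1{k^2+n^2}=\frac1{n^2}-\frac{k^2}{n^2(k^2+n^2)}$: the first part is the Clausen
series, and the second can be differentiated term by term. -/
lemma hasDerivAt_tsum_sinTerm (k : ℕ+) {x : ℝ} (hx : Real.sin (Real.pi * x) ≠ 0) :
    HasDerivAt (fun y => ∑' n, sinTerm y k n)
      (-(2 * Real.pi * Real.log |2 * Real.sin (Real.pi * x)|)
        - 2 * Real.pi * (k : ℝ) ^ 2 * ∑' n, cosTerm x k n) x := by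
  -- the difference with the Clausen series converges fast enough
  have hle : ∀ (n : ℕ+) (y : ℝ), ‖Real.sin (2 * Real.pi * n * y) / (n : ℝ) ^ 2 - sinTerm y k n‖
      ≤ 2 * (1 / (n : ℝ) ^ 2) := fun n y => by
    refine (norm_sub_le _ _).trans
      ((add_le_add (abs_sin_div_le n y) (abs_sinTerm_le y k n)).trans_eq (two_mul _).symm)
  have h := hasDerivAt_tsum
    (g := fun (n : ℕ+) y => Real.sin (2 * Real.pi * n * y) / (n : ℝ) ^ 2 - sinTerm y k n)
    (g' := fun n y => 2 * Real.pi * (k : ℝ) ^ 2 * cosTerm y k n)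
    (summable_inv_sq.mul_left (2 * Real.pi * (k : ℝ) ^ 2)) (fun n y => by
      refine (((hasDerivAt_sin_mul n y).div_const ((n : ℝ) ^ 2)).sub
        ((hasDerivAt_sin_mul n y).div_const ((k : ℝ) ^ 2 + (n : ℝ) ^ 2))).congr_deriv ?_
      unfold cosTerm
      field_simp
      ring) (fun n y => by
      rw [norm_mul, Real.norm_of_nonneg (by positivity)]
      gcongr
      exact abs_cosTerm_le y k n)
    (Summable.of_norm_bounded (summable_inv_sq.mul_left 2) fun n => hle n x) x
  rw [tsum_mul_left] at h
  refine ((hasDerivAt_clausen hx).sub h).congr_of_eventuallyEq (Eventually.of_forall fun y => ?_)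
  have h1 : Summable (fun n : ℕ+ => Real.sin (2 * Real.pi * n * y) / (n : ℝ) ^ 2) :=
    Summable.of_norm_bounded summable_inv_sq fun n => abs_sin_div_le n y
  change _ = clausen y - ∑' n : ℕ+, (Real.sin (2 * Real.pi * n * y) / (n : ℝ) ^ 2 - sinTerm y k n)
  rw [h1.tsum_sub (summable_sinTerm y k), clausen]
  ring

/-- Let $S$, $C$ be the inner sine and cosine sums and $L=\log|2\sin\pi x|$. Since $C'=-2\pi S$ and
$S'=-2\pi L-2\pi k^2C$, the combination $k^2S-k^3C$ has derivative $2\pi k(k^2S-k^3C)-2\pi k^2L$,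
and the factor $e^{-2\pi kx}$ removes the first part. -/
lemma hasDerivAt_trigTerm (k : ℕ+) {x : ℝ} (hx : Real.sin (Real.pi * x) ≠ 0) :
    HasDerivAt (fun y => trigTerm y k)
      (-(2 * Real.pi * Real.log |2 * Real.sin (Real.pi * x)|) *
        ((k : ℝ) ^ 2 * Real.exp (-(2 * Real.pi * k * x)))) x := by
  have he : HasDerivAt (fun y : ℝ => Real.exp (-(2 * Real.pi * k * y)))
      (Real.exp (-(2 * Real.pi * k * x)) * (-(2 * Real.pi * k))) x := by
    simpa using ((hasDerivAt_id' x).const_mul (2 * Real.pi * k)).neg.exp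
  refine (he.mul (((hasDerivAt_tsum_sinTerm k hx).const_mul ((k : ℝ) ^ 2)).sub
    ((hasDerivAt_tsum_cosTerm k x).const_mul ((k : ℝ) ^ 3)))).congr_deriv ?_
  simp only [Pi.sub_apply]
  ring

lemma continuous_trigTerm (k : ℕ+) : Continuous (fun y => trigTerm y k) := by
  have h1 : Continuous (fun y => ∑' n, sinTerm y k n) :=
    continuous_tsum (fun n => by unfold sinTerm; fun_prop) summable_inv_sq
      fun n y => abs_sinTerm_le y k n
  have h2 : Continuous (fun y => ∑' n, cosTerm y k n) :=
    continuous_tsum (fun n => by unfold cosTerm; fun_prop) summable_inv_sq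
      fun n y => abs_cosTerm_le y k n
  unfold trigTerm
  fun_prop

lemma abs_trigTerm_le {a x : ℝ} (hax : a ≤ x) (k : ℕ+) :
    |trigTerm x k| ≤ 2 * invSqSum * ((k : ℝ) ^ 3 * Real.exp (-(2 * Real.pi * k * a))) := by
  have hk : (1 : ℝ) ≤ k := by exact_mod_cast k.pos
  have h1 : |∑' n, sinTerm x k n| ≤ invSqSum :=
    tsum_of_norm_bounded (f := sinTerm x k) summable_inv_sq.hasSum (abs_sinTerm_le x k)
  have h2 : |∑' n, cosTerm x k n| ≤ invSqSum :=
    tsum_of_norm_bounded (f := cosTerm x k) summable_inv_sq.hasSum (abs_cosTerm_le x k)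
  have hz := invSqSum_nonneg
  unfold trigTerm
  rw [abs_mul, abs_of_pos (Real.exp_pos _)]
  have h3 : |(k : ℝ) ^ 2 * ∑' n, sinTerm x k n - (k : ℝ) ^ 3 * ∑' n, cosTerm x k n| ≤
      (k : ℝ) ^ 3 * invSqSum + (k : ℝ) ^ 3 * invSqSum := by
    refine (abs_sub _ _).trans (add_le_add ?_ ?_) <;>
      rw [abs_mul, abs_of_pos (by positivity)] <;> gcongr
    · norm_num
  calc _ ≤ Real.exp (-(2 * Real.pi * k * a)) *
        ((k : ℝ) ^ 3 * invSqSum + (k : ℝ) ^ 3 * invSqSum) := by gcongr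
    _ = _ := by ring

lemma summable_pow_mul_exp_neg_two_pi (p : ℕ) {a : ℝ} (ha : 0 < a) :
    Summable (fun k : ℕ+ => (k : ℝ) ^ p * Real.exp (-(2 * Real.pi * k * a))) := by
  have := (Real.summable_pow_mul_exp_neg_nat_mul p (r := 2 * Real.pi * a)
    (by positivity)).comp_injective PNat.coe_injective
  refine this.congr fun k => ?_
  simp only [Function.comp]
  ring_nf

lemma summable_trigTerm {x : ℝ} (hx : 0 < x) : Summable (trigTerm x) :=
  Summable.of_norm_bounded ((summable_pow_mul_exp_neg_two_pi 3 hx).mul_left _)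
    (abs_trigTerm_le le_rfl)

lemma continuousAt_tsum_trigTerm {x : ℝ} (hx : 0 < x) :
    ContinuousAt (fun y => ∑' k, trigTerm y k) x := by
  have h : ContinuousOn (fun y => ∑' k, trigTerm y k) (Set.Ioi (x / 2)) :=
    continuousOn_tsum (fun k => (continuous_trigTerm k).continuousOn)
      ((summable_pow_mul_exp_neg_two_pi 3 (half_pos hx)).mul_left _)
      fun k y hy => abs_trigTerm_le (le_of_lt hy) k
  exact h.continuousAt (Ioi_mem_nhds (by linarith))

lemma hasSum_sq_mul_exp_neg {x : ℝ} (hx : 0 < x) :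
    HasSum (fun k : ℕ+ => (k : ℝ) ^ 2 * Real.exp (-(2 * Real.pi * k * x)))
      (Real.cosh (Real.pi * x) / (4 * Real.sinh (Real.pi * x) ^ 3)) := by
  set q := Real.exp (-(2 * Real.pi * x)) with hq
  have hq0 : 0 < q := Real.exp_pos _
  have hq1 : q < 1 := Real.exp_lt_one_iff.mpr (by simp only [neg_neg_iff_pos]; positivity)
  have hqn : ‖q‖ < 1 := by rwa [Real.norm_of_nonneg hq0.le]
  -- With $k=n+1$, $k^2=2\binom{n+2}2-\binom{n+1}1$.
  have h1 := (hasSum_choose_mul_geometric_of_norm_lt_one 2 hqn).mul_left 2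
  have h2 := hasSum_choose_mul_geometric_of_norm_lt_one 1 hqn
  have h3 := (h1.sub h2).mul_left q
  have hpow : ∀ n : ℕ, Real.exp (-(2 * Real.pi * n * x)) = q ^ n := fun n => by
    rw [hq, ← Real.exp_nat_mul]; ring_nf
  have hval : q * (2 * (1 / (1 - q) ^ (2 + 1)) - 1 / (1 - q) ^ (1 + 1)) =
      Real.cosh (Real.pi * x) / (4 * Real.sinh (Real.pi * x) ^ 3) := by
    have hs := sinh_pi_pos hx
    have hd : 0 < 1 - q := by linarith
    have hpi : q = Real.exp (-(Real.pi * x)) ^ 2 := by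
      rw [hq, ← Real.exp_nat_mul]; push_cast; ring_nf
    set u := Real.exp (-(Real.pi * x)) with hu
    have hu0 : 0 < u := Real.exp_pos _
    have huinv : Real.exp (Real.pi * x) = 1 / u := by rw [hu, Real.exp_neg]; simp
    have hc : Real.cosh (Real.pi * x) = (1 + q) / (2 * u) := by
      rw [Real.cosh_eq, ← hu, huinv, hpi]; field_simp
    have hs' : Real.sinh (Real.pi * x) = (1 - q) / (2 * u) := by
      rw [Real.sinh_eq, ← hu, huinv, hpi]; field_simp
    rw [hc, hs']
    field_simp
    rw [hpi]
    ring
  rw [hval] at h3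
  rw [hasSum_pnat_iff_hasSum_succ (f := fun n : ℕ => (n : ℝ) ^ 2 *
    Real.exp (-(2 * Real.pi * n * x)))]
  refine h3.congr_terms fun n => ?_
  rw [hpow, Nat.choose_one_right]
  have hch : 2 * (((n + 2).choose 2 : ℕ) : ℝ) = (n + 2) * (n + 1) := by
    rw [Nat.cast_choose_two]
    push_cast
    ring
  push_cast
  rw [pow_succ]
  linear_combination (-(q * q ^ n)) * hch

lemma sin_pi_mul_ne_zero_of_ne {x : ℝ} (hx : 0 < x) (hn : ∀ m : ℕ+, x ≠ m) :
    Real.sin (Real.pi * x) ≠ 0 := by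
  intro h
  obtain ⟨n, h⟩ := Real.sin_eq_zero_iff.mp h
  have h' : (n : ℝ) = x := by
    rw [mul_comm] at h
    exact mul_left_cancel₀ Real.pi_ne_zero h
  have hpos : 0 < n := by
    have : (0 : ℝ) < n := h' ▸ hx
    exact_mod_cast this
  refine hn ⟨n.toNat, by omega⟩ ?_
  rw [← h']
  change (n : ℝ) = ((n.toNat : ℕ) : ℝ)
  rw [← Int.cast_natCast, Int.toNat_of_nonneg hpos.le]

lemma hasDerivAt_tsum_trigTerm {x : ℝ} (hx : 0 < x) (hs : Real.sin (Real.pi * x) ≠ 0) :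
    HasDerivAt (fun y => ∑' k, trigTerm y k)
      (-(2 * Real.pi * Real.log |2 * Real.sin (Real.pi * x)|) *
        (Real.cosh (Real.pi * x) / (4 * Real.sinh (Real.pi * x) ^ 3))) x := by
  have hL : ContinuousAt (fun y => -(2 * Real.pi * Real.log |2 * Real.sin (Real.pi * y)|)) x := by
    refine ((ContinuousAt.log (by fun_prop) ?_).const_mul _).neg
    simpa using hs
  -- Near $x$ the logarithmic factor, common to all $k$, is bounded and $y>x/2$; this yields the
  -- majorant for the derivatives.
  have hev : ∀ᶠ y in 𝓝 x, Real.sin (Real.pi * y) ≠ 0 ∧ x / 2 < y ∧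
      |-(2 * Real.pi * Real.log |2 * Real.sin (Real.pi * y)|)| <
        |-(2 * Real.pi * Real.log |2 * Real.sin (Real.pi * x)|)| + 1 := by
    have hsin : ContinuousAt (fun y => Real.sin (Real.pi * y)) x := by fun_prop
    exact (hsin.eventually_ne hs).and ((lt_mem_nhds (by linarith)).and
      (hL.abs.eventually_lt_const (by linarith)))
  obtain ⟨δ, hδ, hball⟩ := Metric.eventually_nhds_iff_ball.mp hev
  have hu := (summable_pow_mul_exp_neg_two_pi 2 (half_pos hx)).mul_left
    (|-(2 * Real.pi * Real.log |2 * Real.sin (Real.pi * x)|)| + 1)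
  have h := hasDerivAt_tsum_of_isPreconnected (g := fun k y => trigTerm y k)
    (g' := fun k y => -(2 * Real.pi * Real.log |2 * Real.sin (Real.pi * y)|) *
        ((k : ℝ) ^ 2 * Real.exp (-(2 * Real.pi * k * y)))) hu Metric.isOpen_ball
    (convex_ball x δ).isPreconnected (fun k y hy => hasDerivAt_trigTerm k (hball y hy).1)
    (fun k y hy => by
      have := hball y hy
      rw [norm_mul, Real.norm_eq_abs, Real.norm_of_nonneg (r := (k : ℝ) ^ 2 * _) (by positivity)]
      have h1 := this.2.1.le
      have h2 := this.2.2.le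
      gcongr)
    (Metric.mem_ball_self hδ) (summable_trigTerm hx) (Metric.mem_ball_self hδ)
  rwa [tsum_mul_left, (hasSum_sq_mul_exp_neg hx).tsum_eq] at h

end Trig

/-! ### Derivatives of the other terms -/

lemma abs_log_le_add_inv {u : ℝ} (hu : 0 < u) : |Real.log u| ≤ u + 1 / u := by
  have h1 := Real.log_le_sub_one_of_pos hu
  have h2 := Real.log_le_sub_one_of_pos (x := 1 / u) (by positivity)
  rw [Real.log_div one_ne_zero hu.ne', Real.log_one] at h2
  have h3 : 0 < 1 / u := by positivity
  rw [abs_le]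
  constructor <;> linarith

lemma le_abs_pow_four_sub {x δ : ℝ} (hx : 0 < x) (hδ : 0 ≤ δ) (k : ℕ+) (h : δ ≤ |(k : ℝ) - x|) :
    δ ≤ |(k : ℝ) ^ 4 - x ^ 4| := by
  have hk : (1 : ℝ) ≤ k := by exact_mod_cast k.pos
  rw [show (k : ℝ) ^ 4 - x ^ 4 = ((k : ℝ) - x) * (((k : ℝ) + x) * ((k : ℝ) ^ 2 + x ^ 2)) by ring,
    abs_mul, abs_of_pos (a := ((k : ℝ) + x) * ((k : ℝ) ^ 2 + x ^ 2)) (by positivity)]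
  calc δ = δ * (1 * 1) := by ring
    _ ≤ |(k : ℝ) - x| * (((k : ℝ) + x) * ((k : ℝ) ^ 2 + x ^ 2)) := by
      refine mul_le_mul h (mul_le_mul ?_ ?_ zero_le_one ?_) ?_ (hδ.trans h)
      · linarith
      · nlinarith
      · positivity
      · norm_num

lemma summable_logTerm {x : ℝ} (hx : 0 < x) : Summable (logTerm x) := by
  obtain ⟨δ, hδ, h⟩ := exists_ball_dist_pnat x
  have hs := ((summable_pow_mul_exp_neg 4).add
    ((summable_pow_mul_exp_neg 0).mul_left (x ^ 4 + 1 / δ))).mul_left 16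
  refine Summable.of_norm_bounded hs fun k => ?_
  have hsh := sinh_pi_pos (x := (k : ℝ)) (by positivity)
  rw [logTerm, div_eq_mul_one_div, norm_mul, Real.norm_eq_abs,
    Real.norm_of_nonneg (r := 1 / Real.sinh (Real.pi * k) ^ 2) (by positivity)]
  have h1 : abs (Real.log |(k : ℝ) ^ 4 - x ^ 4|) ≤ (k : ℝ) ^ 4 + (x ^ 4 + 1 / δ) := by
    -- At $k=x$ the logarithm is that of 0, with value 0.
    by_cases hk : (k : ℝ) = x
    · rw [hk]; simp; positivity
    have h2 := le_abs_pow_four_sub hx hδ.le k (h k hk x (Metric.mem_ball_self hδ))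
    have h3 : |(k : ℝ) ^ 4 - x ^ 4| ≤ (k : ℝ) ^ 4 + x ^ 4 := by
      refine (abs_sub _ _).trans_eq ?_
      rw [abs_of_nonneg (by positivity), abs_of_nonneg (by positivity)]
    have h4 : 1 / |(k : ℝ) ^ 4 - x ^ 4| ≤ 1 / δ := by gcongr
    have h5 := abs_log_le_add_inv (hδ.trans_le h2)
    linarith
  calc _ ≤ ((k : ℝ) ^ 4 + (x ^ 4 + 1 / δ)) * (16 * Real.exp (-(k : ℝ))) := by
        gcongr
        exact inv_sinh_sq_le k
    _ = _ := by ring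

lemma hasDerivAt_logTerm {x : ℝ} (hx : 0 < x) (k : ℕ+) (hk : (k : ℝ) ≠ x) :
    HasDerivAt (fun y => logTerm y k)
      (4 * x ^ 3 / ((x ^ 4 - (k : ℝ) ^ 4) * Real.sinh (Real.pi * k) ^ 2)) x := by
  have h0 : (k : ℝ) ^ 4 - x ^ 4 ≠ 0 := by
    have := le_abs_pow_four_sub hx (abs_nonneg _) k le_rfl
    exact abs_pos.mp ((abs_pos.mpr (sub_ne_zero.mpr hk)).trans_le this)
  have h1 : HasDerivAt (fun y : ℝ => (k : ℝ) ^ 4 - y ^ 4) (-(4 * x ^ 3)) x := by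
    simpa using ((hasDerivAt_id' x).fun_pow 4).const_sub ((k : ℝ) ^ 4)
  have h2 := (h1.log h0).div_const (Real.sinh (Real.pi * k) ^ 2)
  simp only [logTerm, Real.log_abs]
  refine h2.congr_deriv ?_
  rw [← neg_sub (x ^ 4), neg_div_neg_eq, div_div]

/-- The injection `e` serves two cases: all $k$ when $x$ is not an integer, and $k\ne m$ when $x=m$.
-/
lemma hasDerivAt_tsum_logTerm {ι : Type*} {e : ι → ℕ+} (he : Function.Injective e) {x : ℝ}
    (hx : 0 < x) (hk : ∀ i, (e i : ℝ) ≠ x) :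
    HasDerivAt (fun y => ∑' i, logTerm y (e i))
      (∑' i, 4 * x ^ 3 / ((x ^ 4 - (e i : ℝ) ^ 4) * Real.sinh (Real.pi * e i) ^ 2)) x := by
  obtain ⟨δ, hδ, h⟩ := exists_ball_dist_pnat x
  set ρ := min δ x with hρ
  have hρ0 : 0 < ρ := lt_min hδ hx
  have hmem : ∀ y ∈ Metric.ball x ρ, 0 < y ∧ y ≤ 2 * x ∧ ∀ i, δ ≤ |(e i : ℝ) - y| := by
    intro y hy
    have h1 := (Metric.mem_ball.mp hy).trans_le (min_le_right δ x)
    rw [Real.dist_eq, abs_lt] at h1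
    exact ⟨by linarith, by linarith, fun i => h _ (hk i) y
      (Metric.ball_subset_ball (min_le_left _ _) hy)⟩
  have hne : ∀ y ∈ Metric.ball x ρ, ∀ i, (e i : ℝ) ≠ y := fun y hy i hi => by
    have := (hmem y hy).2.2 i
    rw [hi] at this
    simp at this
    linarith
  have hu : Summable (fun i : ι => 4 * (2 * x) ^ 3 / δ * 16 *
      ((e i : ℝ) ^ 0 * Real.exp (-(e i : ℝ)))) :=
    ((summable_pow_mul_exp_neg 0).comp_injective he).mul_left _
  refine hasDerivAt_tsum_of_isPreconnected (g := fun i y => logTerm y (e i))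
    (g' := fun i y => 4 * y ^ 3 / ((y ^ 4 - (e i : ℝ) ^ 4) * Real.sinh (Real.pi * e i) ^ 2)) hu
    Metric.isOpen_ball (convex_ball x ρ).isPreconnected
    (fun i y hy => hasDerivAt_logTerm (hmem y hy).1 (e i) (hne y hy i)) (fun i y hy => ?_)
    (Metric.mem_ball_self hρ0) ((summable_logTerm hx).comp_injective he)
    (Metric.mem_ball_self hρ0)
  obtain ⟨h1, h2, h3⟩ := hmem y hy
  have h4 := le_abs_pow_four_sub h1 hδ.le (e i) (h3 i)
  have hsh := sinh_pi_pos (x := (e i : ℝ)) (by positivity)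
  rw [Real.norm_eq_abs, abs_div, abs_mul (y ^ 4 - _), abs_sub_comm (y ^ 4),
    abs_of_pos (a := 4 * y ^ 3) (by positivity),
    abs_of_pos (a := Real.sinh (Real.pi * e i) ^ 2) (by positivity)]
  calc 4 * y ^ 3 / (|(e i : ℝ) ^ 4 - y ^ 4| * Real.sinh (Real.pi * e i) ^ 2)
      ≤ 4 * (2 * x) ^ 3 / (δ * Real.sinh (Real.pi * e i) ^ 2) := by gcongr
    _ = 4 * (2 * x) ^ 3 / δ * (1 / Real.sinh (Real.pi * e i) ^ 2) := by
      rw [div_mul_div_comm, mul_one]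
    _ ≤ 4 * (2 * x) ^ 3 / δ * (16 * Real.exp (-(e i : ℝ))) := by
      gcongr
      exact inv_sinh_sq_le _
    _ = _ := by ring

lemma summable_deriv_logTerm {x : ℝ} (hx : 0 < x) (hn : ∀ m : ℕ+, x ≠ m) :
    Summable (fun k : ℕ+ =>
      4 * x ^ 3 / ((x ^ 4 - (k : ℝ) ^ 4) * Real.sinh (Real.pi * k) ^ 2)) := by
  obtain ⟨δ, hδ, h⟩ := exists_ball_dist_pnat x
  refine Summable.of_norm_bounded
    ((summable_pow_mul_exp_neg 0).mul_left (4 * x ^ 3 / δ * 16)) fun k => ?_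
  have h4 := le_abs_pow_four_sub hx hδ.le k (h k (hn k).symm x (Metric.mem_ball_self hδ))
  have hsh := sinh_pi_pos (x := (k : ℝ)) (by positivity)
  rw [Real.norm_eq_abs, abs_div, abs_mul (x ^ 4 - _), abs_sub_comm (x ^ 4),
    abs_of_pos (a := 4 * x ^ 3) (by positivity),
    abs_of_pos (a := Real.sinh (Real.pi * k) ^ 2) (by positivity)]
  calc 4 * x ^ 3 / (|(k : ℝ) ^ 4 - x ^ 4| * Real.sinh (Real.pi * k) ^ 2)
      ≤ 4 * x ^ 3 / (δ * Real.sinh (Real.pi * k) ^ 2) := by gcongr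
    _ = 4 * x ^ 3 / δ * (1 / Real.sinh (Real.pi * k) ^ 2) := by
      rw [div_mul_div_comm, mul_one]
    _ ≤ 4 * x ^ 3 / δ * (16 * Real.exp (-(k : ℝ))) := by
      gcongr
      exact inv_sinh_sq_le _
    _ = _ := by ring

lemma two_mul_abs_div_sq_le (k : ℕ+) (y : ℝ) :
    2 * (k : ℝ) * |y| / ((k : ℝ) ^ 2 + y ^ 2) ^ 2 ≤ 1 / (k : ℝ) ^ 2 := by
  rw [div_le_div_iff₀ (by positivity) (by positivity), one_mul, sq ((k : ℝ) ^ 2 + y ^ 2)]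
  have h1 : 2 * (k : ℝ) * |y| ≤ (k : ℝ) ^ 2 + y ^ 2 := by
    nlinarith [sq_nonneg ((k : ℝ) - |y|), sq_abs y]
  have h2 : (k : ℝ) ^ 2 ≤ (k : ℝ) ^ 2 + y ^ 2 := by linarith [sq_nonneg y]
  gcongr

lemma hasDerivAt_add_sq (c x : ℝ) : HasDerivAt (fun y : ℝ => c ^ 2 + y ^ 2) (2 * x) x := by
  simpa using ((hasDerivAt_id' x).fun_pow 2).const_add (c ^ 2)

lemma summable_deriv_ratTerm (x : ℝ) :
    Summable (fun k : ℕ+ => 2 * (k : ℝ) * x / ((k : ℝ) ^ 2 + x ^ 2) ^ 2) := by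
  refine Summable.of_norm_bounded summable_inv_sq fun k => ?_
  rw [norm_div, norm_mul, Real.norm_of_nonneg (r := 2 * (k : ℝ)) (by positivity),
    Real.norm_of_nonneg (r := (_ : ℝ) ^ 2) (by positivity)]
  exact two_mul_abs_div_sq_le k x

lemma hasDerivAt_tsum_ratTerm (x : ℝ) :
    HasDerivAt (fun y => ∑' k, ratTerm y k)
      (∑' k : ℕ+, 2 * (k : ℝ) * x / ((k : ℝ) ^ 2 + x ^ 2) ^ 2) x := by
  refine hasDerivAt_tsum (g := fun k y => ratTerm y k)
    (g' := fun k y => 2 * (k : ℝ) * y / ((k : ℝ) ^ 2 + y ^ 2) ^ 2) summable_inv_sq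
    (fun k y => ?_) (fun k y => ?_) (summable_ratTerm x) x
  · have h1 : HasDerivAt (fun y : ℝ => y ^ 2) (2 * y) y := by
      simpa using (hasDerivAt_id' y).fun_pow 2
    refine (h1.fun_div ((hasDerivAt_add_sq k y).const_mul (k : ℝ))
      (by positivity)).congr_deriv ?_
    field_simp
    ring
  · rw [norm_div, norm_mul, Real.norm_of_nonneg (r := 2 * (k : ℝ)) (by positivity),
      Real.norm_of_nonneg (r := (_ : ℝ) ^ 2) (by positivity)]
    exact two_mul_abs_div_sq_le k y

lemma abs_deriv_expPlusTerm_le (k : ℕ+) (y : ℝ) :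
    ‖-(4 * (k : ℝ) * y / (((k : ℝ) ^ 2 + y ^ 2) ^ 2 * (Real.exp (2 * Real.pi * k) - 1)))‖ ≤
      4 * ((k : ℝ) ^ 0 * Real.exp (-(k : ℝ))) := by
  have hE := exp_two_pi_sub_one_pos k
  have hk : (1 : ℝ) ≤ k := by exact_mod_cast k.pos
  rw [norm_neg, norm_div, norm_mul, Real.norm_of_nonneg (r := 4 * (k : ℝ)) (by positivity),
    Real.norm_of_nonneg (r := (_ : ℝ) ^ 2 * _) (by positivity), Real.norm_eq_abs]
  calc 4 * (k : ℝ) * |y| / (((k : ℝ) ^ 2 + y ^ 2) ^ 2 * (Real.exp (2 * Real.pi * k) - 1))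
      = 2 * (2 * (k : ℝ) * |y| / ((k : ℝ) ^ 2 + y ^ 2) ^ 2) *
        (1 / (Real.exp (2 * Real.pi * k) - 1)) := by field_simp; ring
    _ ≤ 2 * (1 / (k : ℝ) ^ 2) * (2 * Real.exp (-(k : ℝ))) := by
      exact mul_le_mul (mul_le_mul_of_nonneg_left (two_mul_abs_div_sq_le k y) zero_le_two)
        (inv_exp_sub_one_le k) (by positivity) (by positivity)
    _ ≤ 2 * (1 / 1 ^ 2) * (2 * Real.exp (-(k : ℝ))) := by gcongr
    _ = _ := by ring

lemma summable_deriv_expPlusTerm (x : ℝ) :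
    Summable (fun k : ℕ+ =>
      -(4 * (k : ℝ) * x / (((k : ℝ) ^ 2 + x ^ 2) ^ 2 * (Real.exp (2 * Real.pi * k) - 1)))) :=
  Summable.of_norm_bounded ((summable_pow_mul_exp_neg 0).mul_left 4)
    fun k => abs_deriv_expPlusTerm_le k x

lemma hasDerivAt_tsum_expPlusTerm (x : ℝ) :
    HasDerivAt (fun y => ∑' k, expPlusTerm y k)
      (∑' k : ℕ+, -(4 * (k : ℝ) * x /
        (((k : ℝ) ^ 2 + x ^ 2) ^ 2 * (Real.exp (2 * Real.pi * k) - 1)))) x := by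
  refine hasDerivAt_tsum (g := fun k y => expPlusTerm y k)
    (g' := fun k y => -(4 * (k : ℝ) * y /
        (((k : ℝ) ^ 2 + y ^ 2) ^ 2 * (Real.exp (2 * Real.pi * k) - 1))))
    ((summable_pow_mul_exp_neg 0).mul_left 4)
    (fun k y => ?_) (fun k y => abs_deriv_expPlusTerm_le k y) (summable_expPlusTerm x) x
  have hE := exp_two_pi_sub_one_pos k
  refine ((hasDerivAt_const y (2 * (k : ℝ))).fun_div
    ((hasDerivAt_add_sq k y).mul_const (Real.exp (2 * Real.pi * k) - 1))
      (by positivity)).congr_deriv ?_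
  field_simp
  ring

lemma hasDerivAt_sinh_sq_inv {x : ℝ} (hx : 0 < x) :
    HasDerivAt (fun y => 1 / Real.sinh (Real.pi * y) ^ 2)
      (-(2 * Real.pi * Real.cosh (Real.pi * x) / Real.sinh (Real.pi * x) ^ 3)) x := by
  have hs := sinh_pi_pos hx
  have h1 := ((hasDerivAt_id' x).const_mul Real.pi).sinh.fun_pow 2
  refine ((hasDerivAt_const x (1 : ℝ)).fun_div h1 (by positivity)).congr_deriv ?_
  field_simp
  ring

lemma hasDerivAt_logSin {x : ℝ} (hx : 0 < x) (hs : Real.sin (Real.pi * x) ≠ 0) :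
    HasDerivAt logSin
      (Real.pi ^ 2 * Real.cot (Real.pi * x) / (2 * Real.sinh (Real.pi * x) ^ 2) -
        Real.pi ^ 2 * Real.log |2 * Real.sin (Real.pi * x)| * Real.cosh (Real.pi * x) /
          Real.sinh (Real.pi * x) ^ 3) x := by
  have hsh := sinh_pi_pos hx
  have h1 := (((hasDerivAt_id' x).const_mul Real.pi).sin.const_mul 2).log
    (mul_ne_zero two_ne_zero hs)
  have h2 := (h1.fun_mul (hasDerivAt_sinh_sq_inv hx)).const_mul (Real.pi / 2)
  refine (h2.congr_of_eventuallyEq (Eventually.of_forall fun y => ?_)).congr_deriv ?_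
  · simp only [logSin, Real.log_abs]
    ring
  · rw [Real.cot_eq_cos_div_sin, Real.log_abs]
    field_simp
    ring

lemma hasDerivAt_gammaRHS {x : ℝ} (hx : 0 < x) (hn : ∀ m : ℕ+, x ≠ m) :
    HasDerivAt gammaRHS 0 x := by
  have hs := sin_pi_mul_ne_zero_of_ne hx hn
  have hsh := sinh_pi_pos hx
  have h1 := (Real.hasDerivAt_log hx.ne').const_mul (Real.pi / 3)
  have h2 : HasDerivAt (fun y : ℝ => 1 / (4 * Real.pi * y ^ 2)) (-(1 / (2 * Real.pi * x ^ 3))) x := by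
    have h : HasDerivAt (fun y : ℝ => 4 * Real.pi * y ^ 2) (4 * Real.pi * (2 * x)) x := by
      simpa using ((hasDerivAt_id' x).fun_pow 2).const_mul (4 * Real.pi)
    refine ((hasDerivAt_const x (1 : ℝ)).fun_div h (by positivity)).congr_deriv ?_
    field_simp
    ring
  have h3 := ((((((h1.add h2).add (hasDerivAt_logSin hx hs)).sub
    (hasDerivAt_tsum_ratTerm x)).add (hasDerivAt_tsum_expPlusTerm x)).sub
    ((hasDerivAt_tsum_logTerm (e := fun k : ℕ+ => k) Function.injective_id hx
      fun k => (hn k).symm).const_mul (Real.pi / 2))).sub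
    ((hasDerivAt_tsum_trigTerm hx hs).const_mul (2 * Real.pi)))
  refine (h3.congr_of_eventuallyEq (Eventually.of_forall fun y => rfl)).congr_deriv ?_
  have h4 := (((summable_deriv_ratTerm x).hasSum.neg).add
    (summable_deriv_expPlusTerm x).hasSum).sub
    ((summable_deriv_logTerm hx hn).hasSum.mul_left (Real.pi / 2))
  -- The three rational series together are $-\frac1{2\pi}$ times the expansion of $\cot(\pi
  -- x)/\sinh^2(\pi x)$.
  have h5 := h4.unique
    (((hasSum_cot_mul_csch_sq hx hn).mul_left (-(1 / (2 * Real.pi)))).congr_terms fun k => by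
      have hE := exp_two_pi_sub_one_pos k
      have hk := sinh_pi_pos (x := (k : ℝ)) (by positivity)
      have h0 := sq_sub_sq_ne_zero hx hn k
      have h6 : x ^ 4 - (k : ℝ) ^ 4 = (x ^ 2 - (k : ℝ) ^ 2) * (x ^ 2 + (k : ℝ) ^ 2) := by ring
      rw [coth_eq (x := (k : ℝ)) (by positivity), h6]
      generalize Real.exp (2 * Real.pi * k) - 1 = E at *
      field_simp
      ring)
  have h6 : -(1 / (2 * Real.pi)) *
      (Real.pi ^ 3 * Real.cot (Real.pi * x) / Real.sinh (Real.pi * x) ^ 2 - 1 / x ^ 3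
        + 2 * Real.pi ^ 2 / (3 * x)) =
      -(Real.pi ^ 2 * Real.cot (Real.pi * x) / (2 * Real.sinh (Real.pi * x) ^ 2)) +
        1 / (2 * Real.pi * x ^ 3) - Real.pi / 3 * x⁻¹ := by
    field_simp
    ring
  have h7 : 2 * Real.pi * (-(2 * Real.pi * Real.log |2 * Real.sin (Real.pi * x)|) *
        (Real.cosh (Real.pi * x) / (4 * Real.sinh (Real.pi * x) ^ 3))) =
      -(Real.pi ^ 2 * Real.log |2 * Real.sin (Real.pi * x)| * Real.cosh (Real.pi * x) /
          Real.sinh (Real.pi * x) ^ 3) := by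
    field_simp
    ring
  rw [h6] at h5
  rw [h7]
  linear_combination h5

/-! ### Continuity at the integers, and constancy -/

section IntegerPoints

/-- Both $2\sin\pi x$ and $x^4-m^4$ equal a slope times $x-m$. The coefficients of $\log|x-m|$
differ by $O(x-m)$, so its contribution vanishes, and the slopes leave $\log(2\pi)-\log(4m^3)$. -/
lemma tendsto_logSin_sub_logTerm (m : ℕ+) :
    Tendsto (fun x : ℝ => logSin x - Real.pi / 2 * logTerm x m) (𝓝[≠] (m : ℝ))
      (𝓝 (logLimit m)) := by
  have hm : (0 : ℝ) < m := by positivity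
  have hsin : Real.sin (Real.pi * m) = 0 := by
    rw [mul_comm]; exact_mod_cast Real.sin_nat_mul_pi m
  have hcos : |Real.cos (Real.pi * m)| = 1 := by
    have := Real.sin_sq_add_cos_sq (Real.pi * m)
    rw [hsin] at this
    rw [← sq_eq_sq₀ (abs_nonneg _) zero_le_one, sq_abs]
    linarith
  have hcos0 : Real.cos (Real.pi * m) ≠ 0 := by
    intro h; rw [h] at hcos; simp at hcos
  -- the three slopes at `m`
  have d1 : HasDerivAt (fun x : ℝ => 2 * Real.sin (Real.pi * x))
      (2 * (Real.cos (Real.pi * m) * Real.pi)) m := by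
    simpa using ((hasDerivAt_id' (m : ℝ)).const_mul Real.pi).sin.const_mul 2
  have d2 : HasDerivAt (fun x : ℝ => x ^ 4) (4 * (m : ℝ) ^ 3) m := by
    simpa using (hasDerivAt_id' (m : ℝ)).fun_pow 4
  have s1 := hasDerivAt_iff_tendsto_slope.mp d1
  have s2 := hasDerivAt_iff_tendsto_slope.mp d2
  have s3 := hasDerivAt_iff_tendsto_slope.mp (hasDerivAt_sinh_sq_inv hm)
  set S := slope (fun x : ℝ => 2 * Real.sin (Real.pi * x)) (m : ℝ) with hS
  set P := slope (fun x : ℝ => x ^ 4) (m : ℝ) with hP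
  set T := slope (fun y => 1 / Real.sinh (Real.pi * y) ^ 2) (m : ℝ) with hT
  have hne1 : 2 * (Real.cos (Real.pi * m) * Real.pi) ≠ 0 :=
    mul_ne_zero two_ne_zero (mul_ne_zero hcos0 Real.pi_ne_zero)
  have hne2 : 4 * (m : ℝ) ^ 3 ≠ 0 := by positivity
  have l1 := s1.log hne1
  have l2 := s2.log hne2
  have hsub : Tendsto (fun x : ℝ => x - m) (𝓝[≠] (m : ℝ)) (𝓝 0) := by
    have : Tendsto (fun x : ℝ => x - m) (𝓝 (m : ℝ)) (𝓝 ((m : ℝ) - m)) := by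
      apply Continuous.tendsto; fun_prop
    rw [sub_self] at this
    exact this.mono_left nhdsWithin_le_nhds
  have hxlog : Tendsto (fun x : ℝ => (x - m) * Real.log (x - m)) (𝓝[≠] (m : ℝ)) (𝓝 0) := by
    have := (Real.continuous_mul_log.tendsto 0).comp hsub
    simpa [Function.comp_def] using this
  have hlim := (((s3.mul ((hsub.mul l1).add hxlog)).add
    ((l1.sub l2).const_mul (1 / Real.sinh (Real.pi * m) ^ 2))).const_mul (Real.pi / 2))
  have hval : Real.pi / 2 * (-(2 * Real.pi * Real.cosh (Real.pi * m) / Real.sinh (Real.pi * m) ^ 3)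
      * (0 * Real.log (2 * (Real.cos (Real.pi * m) * Real.pi)) + 0) +
      1 / Real.sinh (Real.pi * m) ^ 2 * (Real.log (2 * (Real.cos (Real.pi * m) * Real.pi)) -
        Real.log (4 * (m : ℝ) ^ 3))) = logLimit m := by
    have e1 : Real.log (2 * (Real.cos (Real.pi * m) * Real.pi)) = Real.log 2 + Real.log Real.pi := by
      rw [← Real.log_abs, abs_mul, abs_mul, hcos, one_mul, abs_two, abs_of_pos Real.pi_pos,
        Real.log_mul two_ne_zero Real.pi_ne_zero]
    have e2 : Real.log (4 * (m : ℝ) ^ 3) = Real.log 2 + Real.log (2 * (m : ℝ) ^ 3) := by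
      rw [← Real.log_mul two_ne_zero (by positivity)]
      ring_nf
    rw [e1, e2, logLimit]
    ring
  rw [hval] at hlim
  refine hlim.congr' ?_
  filter_upwards [s1.eventually_ne hne1, s2.eventually_ne hne2, self_mem_nhdsWithin]
    with x h1 h2 hx
  have hxm : x - m ≠ 0 := sub_ne_zero.mpr hx
  have f1 : 2 * Real.sin (Real.pi * x) = S x * (x - m) := by
    rw [hS, slope_def_field, hsin]
    field_simp
    ring
  have f2 : (m : ℝ) ^ 4 - x ^ 4 = -(P x * (x - m)) := by
    rw [hP, slope_def_field]
    field_simp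
    ring
  have f3 : 1 / Real.sinh (Real.pi * x) ^ 2 =
      1 / Real.sinh (Real.pi * m) ^ 2 + T x * (x - m) := by
    rw [hT, slope_def_field, div_mul_cancel₀ _ hxm]
    ring
  have f4 : logSin x = Real.pi / 2 * (Real.log |2 * Real.sin (Real.pi * x)| *
      (1 / Real.sinh (Real.pi * x) ^ 2)) := by
    rw [logSin]; ring
  rw [f4, f3, logTerm, Real.log_abs, Real.log_abs, f1, f2, Real.log_neg_eq_log,
    Real.log_mul h1 hxm, Real.log_mul h2 hxm]
  ring

lemma tsum_logTerm_split {x : ℝ} (hx : 0 < x) (m : ℕ+) :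
    ∑' k, logTerm x k = logTerm x m + ∑' k : {k : ℕ+ // k ≠ m}, logTerm x k := by
  have hs := summable_logTerm hx
  have h := (hs.subtype ({m} : Set ℕ+)).tsum_add_tsum_compl (hs.subtype ({m} : Set ℕ+)ᶜ)
  rw [← h]
  exact congrArg (· + _) (tsum_singleton m (logTerm x))

lemma tendsto_gammaRHS (m : ℕ+) :
    Tendsto gammaRHS (𝓝[≠] (m : ℝ)) (𝓝 (gammaRHSInt m)) := by
  have hm : (0 : ℝ) < m := by positivity
  have c1 : ContinuousAt (fun x : ℝ => Real.pi / 3 * Real.log x + 1 / (4 * Real.pi * x ^ 2)) m := by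
    have := Real.continuousAt_log hm.ne'
    have h2 : ContinuousAt (fun x : ℝ => 1 / (4 * Real.pi * x ^ 2)) m := by
      refine continuousAt_const.div (by fun_prop) (by positivity)
    exact (this.const_mul _).add h2
  have c2 := (hasDerivAt_tsum_ratTerm (m : ℝ)).continuousAt
  have c3 := (hasDerivAt_tsum_expPlusTerm (m : ℝ)).continuousAt
  have c4 := (hasDerivAt_tsum_logTerm (e := fun k : {k : ℕ+ // k ≠ m} => (k : ℕ+))
    Subtype.val_injective hm fun k h => k.2 (PNat.coe_injective (by exact_mod_cast h))).continuousAt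
  have c5 := continuousAt_tsum_trigTerm hm
  have c : ∀ {f : ℝ → ℝ}, ContinuousAt f m → Tendsto f (𝓝[≠] (m : ℝ)) (𝓝 (f m)) :=
    fun h => h.tendsto.mono_left nhdsWithin_le_nhds
  have h := (((((c c1).add (tendsto_logSin_sub_logTerm m)).sub (c c2)).add (c c3)).sub
    ((c c4).const_mul (Real.pi / 2))).sub ((c c5).const_mul (2 * Real.pi))
  refine (h.congr' ?_)
  filter_upwards [mem_nhdsWithin_of_mem_nhds (lt_mem_nhds hm)] with x hx
  rw [gammaRHS, tsum_logTerm_split hx m]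
  ring

lemma eventually_ne_pnat (x : ℝ) : ∀ᶠ y : ℝ in 𝓝[≠] x, ∀ m : ℕ+, y ≠ m := by
  obtain ⟨δ, hδ, h⟩ := exists_ball_dist_pnat x
  filter_upwards [mem_nhdsWithin_of_mem_nhds (Metric.ball_mem_nhds x hδ), self_mem_nhdsWithin]
    with y hy hyx m hm
  have h1 := h m (fun h0 => hyx (by rw [Set.mem_singleton_iff, hm, h0])) y hy
  rw [hm] at h1
  simp at h1
  linarith

open Classical in
/-- The right-hand side of the formula for `-γ`, extended to the positive integers by its limits. -/
noncomputable def gammaExt (x : ℝ) : ℝ :=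
  if h : ∃ m : ℕ+, x = m then gammaRHSInt h.choose else gammaRHS x

lemma gammaExt_of_ne {x : ℝ} (hn : ∀ m : ℕ+, x ≠ m) : gammaExt x = gammaRHS x :=
  dif_neg (by push Not; exact hn)

lemma gammaExt_pnat (m : ℕ+) : gammaExt m = gammaRHSInt m := by
  have h : ∃ m' : ℕ+, (m : ℝ) = m' := ⟨m, rfl⟩
  have h2 : h.choose = m := PNat.coe_injective (by exact_mod_cast h.choose_spec.symm)
  rw [gammaExt, dif_pos h, h2]

lemma hasDerivAt_gammaExt {x : ℝ} (hx : 0 < x) (hn : ∀ m : ℕ+, x ≠ m) :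
    HasDerivAt gammaExt 0 x := by
  refine (hasDerivAt_gammaRHS hx hn).congr_of_eventuallyEq ?_
  have h : ∀ᶠ y : ℝ in 𝓝 x, ∀ m : ℕ+, y ≠ m := by
    have := eventually_nhdsWithin_iff.mp (eventually_ne_pnat x)
    filter_upwards [this] with y hy
    by_cases hyx : y = x
    · rw [hyx]; exact hn
    · exact hy hyx
  filter_upwards [h] with y hy using gammaExt_of_ne hy

lemma continuousAt_gammaExt {x : ℝ} (hx : 0 < x) : ContinuousAt gammaExt x := by
  by_cases hn : ∀ m : ℕ+, x ≠ m
  · exact (hasDerivAt_gammaExt hx hn).continuousAt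
  · push Not at hn
    obtain ⟨m, rfl⟩ := hn
    rw [continuousAt_iff_punctured_nhds, gammaExt_pnat]
    refine (tendsto_gammaRHS m).congr' ?_
    filter_upwards [eventually_ne_pnat (m : ℝ)] with y hy using (gammaExt_of_ne hy).symm

/-- Differentiability is not known at the integers; the fundamental theorem of calculus for
continuous functions allows this countable exceptional set. -/
lemma gammaExt_eq {a b : ℝ} (ha : 0 < a) (hb : 0 < b) : gammaExt b = gammaExt a := by
  have hpos : ∀ x, min a b ≤ x → 0 < x := fun x hx => (lt_min ha hb).trans_le hx
  have h := MeasureTheory.integral_eq_of_hasDerivAt_off_countable gammaExt (fun _ => 0)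
    (a := a) (b := b) (Set.countable_range (fun m : ℕ+ => (m : ℝ)))
    (fun x hx => (continuousAt_gammaExt (hpos x hx.1)).continuousWithinAt)
    (fun x hx => hasDerivAt_gammaExt (hpos x hx.1.1.le) fun m hm => hx.2 ⟨m, hm.symm⟩)
    (by simp)
  rw [intervalIntegral.integral_zero] at h
  linarith

end IntegerPoints

/-! ### Behaviour at infinity -/

section Asymptotics

/-- Half the logarithm of the ratio telescopes and stands in for $k/(k^2+x^2)$, so this series
approximates $\sum_k$ `ratTerm x k`. Summability being given, the value is read off from the partial
sums. -/
lemma hasSum_log_telescope (x : ℝ) (hx : 0 < x)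
    (hs : Summable (fun k : ℕ+ => 1 / (k : ℝ) -
      Real.log ((((k : ℝ) + 1) ^ 2 + x ^ 2) / ((k : ℝ) ^ 2 + x ^ 2)) / 2)) :
    HasSum (fun k : ℕ+ => 1 / (k : ℝ) -
      Real.log ((((k : ℝ) + 1) ^ 2 + x ^ 2) / ((k : ℝ) ^ 2 + x ^ 2)) / 2)
      (Real.eulerMascheroniConstant + Real.log (1 + x ^ 2) / 2) := by
  have h0 := hs.hasSum
  have h1 := (hasSum_pnat_iff_hasSum_succ (f := fun n : ℕ => 1 / (n : ℝ) -
      Real.log ((((n : ℝ) + 1) ^ 2 + x ^ 2) / ((n : ℝ) ^ 2 + x ^ 2)) / 2)).mp h0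
  have h2 := h1.tendsto_sum_nat
  have hsum : ∀ n : ℕ, ∑ i ∈ Finset.range n, (1 / ((i + 1 : ℕ) : ℝ) -
      Real.log (((((i + 1 : ℕ) : ℝ) + 1) ^ 2 + x ^ 2) / (((i + 1 : ℕ) : ℝ) ^ 2 + x ^ 2)) / 2) =
      (harmonic n : ℝ) - Real.log (((n : ℝ) + 1) ^ 2 + x ^ 2) / 2 + Real.log (1 + x ^ 2) / 2 := by
    intro n
    induction n with
    | zero => simp
    | succ n ih =>
      rw [Finset.sum_range_succ, ih, harmonic_succ, Real.log_div (by positivity) (by positivity)]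
      push_cast
      rw [one_div]
      ring
  have h3 : Tendsto (fun n : ℕ => (harmonic n : ℝ) - Real.log (((n : ℝ) + 1) ^ 2 + x ^ 2) / 2 +
      Real.log (1 + x ^ 2) / 2) atTop
      (𝓝 (Real.eulerMascheroniConstant + Real.log (1 + x ^ 2) / 2)) := by
    refine Tendsto.add_const _ ?_
    have h4 : Tendsto (fun n : ℕ => Real.log ((1 + 1 / (n : ℝ)) ^ 2 + (x * (1 / (n : ℝ))) ^ 2) / 2)
        atTop (𝓝 0) := by
      have ht := tendsto_one_div_atTop_nhds_zero_nat (𝕜 := ℝ)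
      have h5 := (((ht.const_add 1).pow 2).add ((ht.const_mul x).pow 2)).log (by norm_num)
      simpa using h5.div_const 2
    have h6 := Real.tendsto_harmonic_sub_log.sub h4
    rw [sub_zero] at h6
    refine h6.congr' ?_
    filter_upwards [eventually_gt_atTop 0] with n hn
    have hn' : (0 : ℝ) < n := by exact_mod_cast hn
    have e : ((n : ℝ) + 1) ^ 2 + x ^ 2 =
        (n : ℝ) ^ 2 * ((1 + 1 / (n : ℝ)) ^ 2 + (x * (1 / (n : ℝ))) ^ 2) := by
      field_simp
    rw [e, Real.log_mul (by positivity) (by positivity), Real.log_pow]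
    push_cast
    ring
  have h7 := tendsto_nhds_unique (h2.congr fun n => by rw [← hsum n]) h3
  rwa [h7] at h0

/-- Apply $1-1/t\le\log t\le t-1$ to the ratio $t=1+(2k+1)/(k^2+x^2)$. -/
lemma abs_log_sub_div_le (x k : ℝ) (hx : 0 < x) (hk : 0 < k) :
    |Real.log (((k + 1) ^ 2 + x ^ 2) / (k ^ 2 + x ^ 2)) / 2 - k / (k ^ 2 + x ^ 2)| ≤
      2 * (1 / (k ^ 2 + x ^ 2)) := by
  set a := k ^ 2 + x ^ 2 with ha
  have ha0 : 0 < a := by positivity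
  have hb : (k + 1) ^ 2 + x ^ 2 = a + (2 * k + 1) := by rw [ha]; ring
  rw [hb]
  have hu : Real.log ((a + (2 * k + 1)) / a) ≤ (2 * k + 1) / a := by
    refine (Real.log_le_sub_one_of_pos (by positivity)).trans_eq ?_
    field_simp
    ring
  have hl : (2 * k + 1) / (a + (2 * k + 1)) ≤ Real.log ((a + (2 * k + 1)) / a) := by
    have := Real.one_sub_inv_le_log_of_pos (x := (a + (2 * k + 1)) / a) (by positivity)
    refine le_trans (le_of_eq ?_) this
    field_simp
    ring
  rw [abs_le]
  constructor
  · have : k / a - 2 * (1 / a) ≤ (2 * k + 1) / (a + (2 * k + 1)) / 2 := by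
      have hka : k ^ 2 ≤ a := by rw [ha]; linarith [sq_nonneg x]
      rw [mul_one_div, ← sub_div, div_div, div_le_div_iff₀ ha0 (by positivity)]
      nlinarith
    linarith
  · have : (2 * k + 1) / a / 2 - k / a ≤ 2 * (1 / a) := by
      rw [show (2 * k + 1) / a / 2 - k / a = (1 / 2) * (1 / a) by ring]
      gcongr
      norm_num
    linarith

lemma summable_inv_add_sq (x : ℝ) : Summable (fun k : ℕ+ => 1 / ((k : ℝ) ^ 2 + x ^ 2)) :=
  Summable.of_nonneg_of_le (fun k => by positivity)
    (fun k => by gcongr; linarith [sq_nonneg x]) summable_inv_sq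

lemma abs_tsum_ratTerm_sub_le {x : ℝ} (hx : 0 < x) :
    |∑' k, ratTerm x k - (Real.eulerMascheroniConstant + Real.log (1 + x ^ 2) / 2)| ≤
      2 * ∑' k : ℕ+, 1 / ((k : ℝ) ^ 2 + x ^ 2) := by
  have hb := fun k : ℕ+ => abs_log_sub_div_le x k hx (by positivity)
  have hd : Summable (fun k : ℕ+ =>
      Real.log ((((k : ℝ) + 1) ^ 2 + x ^ 2) / ((k : ℝ) ^ 2 + x ^ 2)) / 2 -
        (k : ℝ) / ((k : ℝ) ^ 2 + x ^ 2)) :=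
    Summable.of_norm_bounded ((summable_inv_add_sq x).mul_left 2) hb
  have e : ∀ k : ℕ+, 1 / (k : ℝ) -
      Real.log ((((k : ℝ) + 1) ^ 2 + x ^ 2) / ((k : ℝ) ^ 2 + x ^ 2)) / 2 = ratTerm x k -
      (Real.log ((((k : ℝ) + 1) ^ 2 + x ^ 2) / ((k : ℝ) ^ 2 + x ^ 2)) / 2 -
        (k : ℝ) / ((k : ℝ) ^ 2 + x ^ 2)) := by
    intro k
    have : ratTerm x k = 1 / (k : ℝ) - (k : ℝ) / ((k : ℝ) ^ 2 + x ^ 2) := by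
      rw [ratTerm]; field_simp; ring
    rw [this]; ring
  have h1 := hasSum_log_telescope x hx (((summable_ratTerm x).sub hd).congr fun k => (e k).symm)
  have h2 := (summable_ratTerm x).hasSum.sub h1
  refine h2.norm_le_of_bounded ((summable_inv_add_sq x).hasSum.mul_left 2) fun k => ?_
  rw [e k, sub_sub_cancel]
  exact hb k

lemma tendsto_inv_add_sq (c : ℝ) : Tendsto (fun x : ℝ => 1 / (c + x ^ 2)) atTop (𝓝 0) := by
  simp only [one_div]
  exact (tendsto_atTop_add_const_left _ _ (tendsto_pow_atTop two_ne_zero)).inv_tendsto_atTop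

lemma tendsto_tsum_ratTerm :
    Tendsto (fun x : ℝ => ∑' k, ratTerm x k - Real.log x) atTop
      (𝓝 Real.eulerMascheroniConstant) := by
  have h1 : Tendsto (fun x : ℝ => ∑' k : ℕ+, 1 / ((k : ℝ) ^ 2 + x ^ 2)) atTop (𝓝 0) := by
    have := tendsto_tsum_of_dominated_convergence (𝓕 := atTop)
      (f := fun (x : ℝ) (k : ℕ+) => 1 / ((k : ℝ) ^ 2 + x ^ 2)) (g := fun _ => 0) summable_inv_sq
      (fun k => tendsto_inv_add_sq _) (Eventually.of_forall fun x k => by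
        rw [Real.norm_of_nonneg (by positivity)]
        gcongr
        linarith [sq_nonneg x])
    simpa using this
  have h2 : Tendsto (fun x : ℝ => ∑' k, ratTerm x k -
      (Real.eulerMascheroniConstant + Real.log (1 + x ^ 2) / 2)) atTop (𝓝 0) := by
    have h1' := h1.const_mul 2
    rw [mul_zero] at h1'
    refine squeeze_zero_norm' ?_ h1'
    filter_upwards [eventually_gt_atTop 0] with x hx using abs_tsum_ratTerm_sub_le hx
  have h3 : Tendsto (fun x : ℝ => Real.log (1 / (0 + x ^ 2) + 1) / 2) atTop (𝓝 0) := by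
    simpa using (((tendsto_inv_add_sq 0).add_const 1).log (by norm_num)).div_const 2
  have h4 := (h2.add h3).add_const Real.eulerMascheroniConstant
  rw [add_zero, zero_add] at h4
  refine h4.congr' ?_
  filter_upwards [eventually_gt_atTop 0] with x hx
  have e : 1 / (0 + x ^ 2) + 1 = (1 + x ^ 2) / x ^ 2 := by field_simp; ring
  rw [e, Real.log_div (by positivity) (by positivity), Real.log_pow]
  push_cast
  ring

lemma tendsto_tsum_expPlusTerm :
    Tendsto (fun x : ℝ => ∑' k, expPlusTerm x k) atTop (𝓝 0) := by
  have := tendsto_tsum_of_dominated_convergence (𝓕 := atTop)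
    (f := fun (x : ℝ) (k : ℕ+) => expPlusTerm x k) (g := fun _ => 0)
    ((summable_pow_mul_exp_neg 1).mul_left 4)
    (fun k => by
      have := (tendsto_inv_add_sq ((k : ℝ) ^ 2)).const_mul
        (2 * (k : ℝ) / (Real.exp (2 * Real.pi * k) - 1))
      rw [mul_zero] at this
      refine this.congr fun x => ?_
      rw [expPlusTerm, div_mul_div_comm, mul_one, mul_comm (Real.exp _ - 1)])
    (Eventually.of_forall fun x k => abs_expPlusTerm_le x k)
  simpa using this

lemma tendsto_tsum_trigTerm :
    Tendsto (fun x : ℝ => ∑' k, trigTerm x k) atTop (𝓝 0) := by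
  have := tendsto_tsum_of_dominated_convergence (𝓕 := atTop)
    (f := fun (x : ℝ) (k : ℕ+) => trigTerm x k) (g := fun _ => 0)
    ((summable_pow_mul_exp_neg_two_pi 3 one_pos).mul_left (2 * invSqSum))
    (fun k => by
      refine squeeze_zero_norm (fun x => abs_trigTerm_le le_rfl k) ?_
      have h : Tendsto (fun x : ℝ => Real.exp (-(2 * Real.pi * k * x))) atTop (𝓝 0) :=
        Real.tendsto_exp_neg_atTop_nhds_zero.comp
          (tendsto_id.const_mul_atTop (by positivity : (0 : ℝ) < 2 * Real.pi * k))
      simpa using (h.const_mul ((k : ℝ) ^ 3)).const_mul (2 * invSqSum))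
    (by
      filter_upwards [eventually_ge_atTop 1] with x hx k using abs_trigTerm_le hx k)
  simpa using this

/-- `N + 1/2`, along which the singular terms stay bounded. -/
noncomputable def halfInt (N : ℕ) : ℝ := (N : ℝ) + 1 / 2

lemma halfInt_pos (N : ℕ) : 0 < halfInt N := by unfold halfInt; positivity

lemma half_le_abs_sub_halfInt (N : ℕ) (k : ℕ+) : 1 / 2 ≤ |(k : ℝ) - halfInt N| := by
  unfold halfInt
  rcases le_or_gt (k : ℕ) N with h | h
  · have : ((k : ℕ) : ℝ) ≤ N := by exact_mod_cast h
    rw [abs_sub_comm]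
    exact le_trans (by linarith) (le_abs_self _)
  · have : (N : ℝ) + 1 ≤ (k : ℕ) := by exact_mod_cast h
    exact le_trans (by linarith) (le_abs_self _)

lemma halfInt_ne (N : ℕ) (m : ℕ+) : halfInt N ≠ m := by
  intro h
  have := half_le_abs_sub_halfInt N m
  rw [h, sub_self, abs_zero] at this
  linarith

lemma tendsto_halfInt : Tendsto halfInt atTop atTop :=
  tendsto_atTop_add_const_right _ _ tendsto_natCast_atTop_atTop

lemma tendsto_logSin_halfInt : Tendsto (fun N => logSin (halfInt N)) atTop (𝓝 0) := by
  have h1 : ∀ N, |2 * Real.sin (Real.pi * halfInt N)| = 2 := by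
    intro N
    have : Real.pi * halfInt N = Real.pi / 2 + N * Real.pi := by unfold halfInt; ring
    rw [this, Real.sin_add_nat_mul_pi, Real.sin_pi_div_two, mul_one, abs_mul, abs_two, abs_pow,
      abs_neg, abs_one, one_pow, mul_one]
  have h2 : Tendsto (fun x : ℝ => Real.sinh (Real.pi * x)) atTop atTop :=
    tendsto_atTop_mono' _ (by
      filter_upwards [eventually_ge_atTop 0] with x hx
      have h : 0 ≤ Real.pi * x := by positivity
      exact Real.self_le_sinh_iff.mpr h) (tendsto_id.const_mul_atTop Real.pi_pos)
  have h3 : Tendsto (fun x : ℝ => Real.pi * Real.log 2 / (2 * Real.sinh (Real.pi * x) ^ 2)) atTop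
      (𝓝 0) :=
    tendsto_const_nhds.div_atTop
      (((tendsto_pow_atTop two_ne_zero).comp h2).const_mul_atTop two_pos)
  refine (h3.comp tendsto_halfInt).congr fun N => ?_
  simp only [Function.comp, logSin, h1]

/-- `∑ 1 / sinh² (π k)` -/
noncomputable def cschSqSum : ℝ := ∑' k : ℕ+, 1 / Real.sinh (Real.pi * k) ^ 2

lemma summable_inv_sinh_sq : Summable (fun k : ℕ+ => 1 / Real.sinh (Real.pi * k) ^ 2) :=
  Summable.of_nonneg_of_le (fun k => by positivity) (fun k => by
    simpa using inv_sinh_sq_le k) (by simpa using (summable_pow_mul_exp_neg 0).mul_left 16)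

lemma logTerm_sub_halfInt (N : ℕ) (k : ℕ+) :
    logTerm (halfInt N) k - 4 * Real.log (halfInt N) * (1 / Real.sinh (Real.pi * k) ^ 2) =
      Real.log |((k : ℝ) / halfInt N) ^ 4 - 1| * (1 / Real.sinh (Real.pi * k) ^ 2) := by
  have hx := halfInt_pos N
  have h0 : (k : ℝ) ^ 4 - halfInt N ^ 4 ≠ 0 := by
    have := le_abs_pow_four_sub hx (by norm_num) k (half_le_abs_sub_halfInt N k)
    exact abs_pos.mp (by linarith)
  have e : ((k : ℝ) / halfInt N) ^ 4 - 1 = ((k : ℝ) ^ 4 - halfInt N ^ 4) / halfInt N ^ 4 := by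
    field_simp
  rw [e, Real.log_abs, Real.log_div h0 (by positivity), Real.log_pow, logTerm, Real.log_abs]
  push_cast
  ring

/-- A majorant independent of $N$, growing polynomially in $k$, which $\sinh^{-2}(\pi k)$ outweighs
in dominated convergence. -/
lemma abs_log_ratio_le (N : ℕ) (k : ℕ+) :
    abs (Real.log |((k : ℝ) / halfInt N) ^ 4 - 1|) ≤ 16 * (k : ℝ) ^ 4 + 1 + 4 * (k : ℝ) := by
  have hx := halfInt_pos N
  have hk : (1 : ℝ) ≤ k := by exact_mod_cast k.pos
  have hx2 : 1 / 2 ≤ halfInt N := by unfold halfInt; linarith [(Nat.cast_nonneg N : (0 : ℝ) ≤ N)]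
  set u := (k : ℝ) / halfInt N with hu
  have hu0 : 0 < u := by positivity
  have hu2 : u ≤ 2 * k := by
    rw [hu, div_le_iff₀ hx]
    nlinarith
  have hup : |u ^ 4 - 1| ≤ 16 * (k : ℝ) ^ 4 + 1 := by
    refine (abs_sub _ _).trans ?_
    rw [abs_one, abs_of_pos (by positivity)]
    have : u ^ 4 ≤ (2 * (k : ℝ)) ^ 4 := by gcongr
    nlinarith
  have h1 : |u - 1| ≤ |u ^ 4 - 1| := by
    rw [show u ^ 4 - 1 = (u - 1) * ((u + 1) * (u ^ 2 + 1)) by ring, abs_mul,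
      abs_of_pos (a := (u + 1) * (u ^ 2 + 1)) (by positivity)]
    refine le_mul_of_one_le_right (abs_nonneg _) ?_
    nlinarith [sq_nonneg u]
  -- Either $u\le\frac12$, or `halfInt N` is below $2k$ and at distance at least $\frac12$ from $k$.
  have hlow : 1 / (4 * (k : ℝ)) ≤ |u - 1| := by
    rcases le_or_gt u (1 / 2) with h | h
    · rw [abs_sub_comm]
      refine le_trans ?_ (le_abs_self _)
      have : 1 / (4 * (k : ℝ)) ≤ 1 / 2 := by gcongr; linarith
      linarith
    · have h3 : halfInt N < 2 * k := by
        rw [hu, lt_div_iff₀ hx] at h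
        linarith
      have h4 : |u - 1| = |(k : ℝ) - halfInt N| / halfInt N := by
        rw [hu, ← abs_of_pos hx, ← abs_div, abs_of_pos hx, sub_div, div_self hx.ne']
      rw [h4]
      calc 1 / (4 * (k : ℝ)) = (1 / 2) / (2 * k) := by field_simp; norm_num
        _ ≤ |(k : ℝ) - halfInt N| / halfInt N := by
          gcongr
          exact half_le_abs_sub_halfInt N k
  have hlow' := hlow.trans h1
  have hpos : 0 < |u ^ 4 - 1| := lt_of_lt_of_le (by positivity) hlow'
  have h5 : 1 / |u ^ 4 - 1| ≤ 4 * (k : ℝ) := by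
    calc 1 / |u ^ 4 - 1| ≤ 1 / (1 / (4 * (k : ℝ))) := by gcongr
      _ = _ := by simp
  linarith [abs_log_le_add_inv hpos]

lemma tendsto_tsum_logTerm_halfInt :
    Tendsto (fun N => ∑' k, logTerm (halfInt N) k - 4 * Real.log (halfInt N) * cschSqSum) atTop
      (𝓝 0) := by
  have hs : Summable (fun k : ℕ+ => (16 * (k : ℝ) ^ 4 + 1 + 4 * (k : ℝ)) *
      (16 * Real.exp (-(k : ℝ)))) := by
    refine ((((summable_pow_mul_exp_neg 4).mul_left 256).add
      ((summable_pow_mul_exp_neg 0).mul_left 16)).add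
      ((summable_pow_mul_exp_neg 1).mul_left 64)).congr fun k => ?_
    ring
  have := tendsto_tsum_of_dominated_convergence (𝓕 := atTop)
    (f := fun (N : ℕ) (k : ℕ+) =>
      Real.log |((k : ℝ) / halfInt N) ^ 4 - 1| * (1 / Real.sinh (Real.pi * k) ^ 2))
    (g := fun _ => 0) hs
    (fun k => by
      have h1 : Tendsto (fun N => ((k : ℝ) / halfInt N) ^ 4 - 1) atTop (𝓝 (0 ^ 4 - 1)) :=
        ((tendsto_const_nhds.div_atTop tendsto_halfInt).pow 4).sub_const 1
      have h2 := (h1.abs.log (by norm_num)).mul_const (1 / Real.sinh (Real.pi * k) ^ 2)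
      simpa using h2)
    (Eventually.of_forall fun N k => by
      rw [norm_mul, Real.norm_eq_abs,
        Real.norm_of_nonneg (r := 1 / Real.sinh (Real.pi * k) ^ 2) (by positivity)]
      exact mul_le_mul (abs_log_ratio_le N k) (inv_sinh_sq_le k) (by positivity) (by positivity))
  rw [tsum_zero] at this
  refine this.congr fun N => ?_
  rw [cschSqSum, ← tsum_mul_left, ← (summable_logTerm (halfInt_pos N)).tsum_sub
    (summable_inv_sinh_sq.mul_left _)]
  exact tsum_congr fun k => (logTerm_sub_halfInt N k).symm

/-- The coefficient of the logarithm has three sources: $\frac\pi3\log x$, the growth $\log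
x+\gamma$ of the sum of `ratTerm`, and $\log x^4$ extracted from every `logTerm`. -/
lemma tendsto_gammaRHS_halfInt :
    Tendsto (fun N => gammaRHS (halfInt N) -
      (Real.pi / 3 - 1 - 2 * Real.pi * cschSqSum) * Real.log (halfInt N)) atTop
      (𝓝 (-Real.eulerMascheroniConstant)) := by
  have h1 : Tendsto (fun x : ℝ => 1 / (4 * Real.pi) * (1 / (0 + x ^ 2))) atTop (𝓝 0) := by
    simpa using (tendsto_inv_add_sq 0).const_mul (1 / (4 * Real.pi))
  have h := (((((h1.comp tendsto_halfInt).add tendsto_logSin_halfInt).sub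
    (tendsto_tsum_ratTerm.comp tendsto_halfInt)).add
    (tendsto_tsum_expPlusTerm.comp tendsto_halfInt)).sub
    (tendsto_tsum_logTerm_halfInt.const_mul (Real.pi / 2))).sub
    ((tendsto_tsum_trigTerm.comp tendsto_halfInt).const_mul (2 * Real.pi))
  simp only [mul_zero, add_zero, sub_zero, zero_sub] at h
  refine h.congr fun N => ?_
  have hx := halfInt_pos N
  have e : 1 / (4 * Real.pi * halfInt N ^ 2) = 1 / (4 * Real.pi) * (1 / (0 + halfInt N ^ 2)) := by
    field_simp
    ring
  simp only [Function.comp, gammaRHS, e]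
  ring

lemma gammaExt_eq_neg_eulerMascheroniConstant {x : ℝ} (hx : 0 < x) :
    gammaExt x = -Real.eulerMascheroniConstant := by
  have hc : ∀ N, gammaRHS (halfInt N) = gammaExt x := fun N => by
    rw [← gammaExt_of_ne (halfInt_ne N)]
    exact gammaExt_eq hx (halfInt_pos N)
  have h := tendsto_gammaRHS_halfInt
  simp only [hc] at h
  set a := Real.pi / 3 - 1 - 2 * Real.pi * cschSqSum with ha
  have hlog : Tendsto (fun N => Real.log (halfInt N)) atTop atTop :=
    Real.tendsto_log_atTop.comp tendsto_halfInt
  -- Constant minus $a\log x$ has a finite limit; dividing by $\log x\to\infty$ gives $a=0$, that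
  -- is, $\sum_k\sinh^{-2}(\pi k)=\frac16-\frac1{2\pi}$.
  have h2 := (h.const_sub (gammaExt x)).mul hlog.inv_tendsto_atTop
  have h3 : Tendsto (fun _ : ℕ => a) atTop (𝓝 0) := by
    rw [mul_zero] at h2
    refine h2.congr' ?_
    filter_upwards [hlog.eventually_gt_atTop 0] with N hN
    simp only [Pi.inv_apply, sub_sub_cancel]
    field_simp
  have ha0 : a = 0 := tendsto_nhds_unique tendsto_const_nhds h3
  rw [ha0] at h
  simp only [zero_mul, sub_zero] at h
  exact tendsto_nhds_unique tendsto_const_nhds h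

end Asymptotics

end RamanujanPsi

theorem mainTheorem4 :
    -- all series converge
    (∀ x : ℝ, 0 < x →
      Summable (RamanujanPsi.ratTerm x) ∧ Summable (RamanujanPsi.expPlusTerm x) ∧
      Summable (RamanujanPsi.expMinusTerm x) ∧ Summable (RamanujanPsi.logTerm x) ∧
      (∀ k : ℕ+, Summable (RamanujanPsi.sinTerm x k) ∧ Summable (RamanujanPsi.cosTerm x k)) ∧
      Summable (RamanujanPsi.trigTerm x)) ∧
    -- the formula at every `x > 0` that is not an integer
    (∀ x : ℝ, 0 < x → (∀ m : ℕ+, x ≠ m) →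
      -Real.eulerMascheroniConstant = RamanujanPsi.gammaRHS x) ∧
    -- the formula at a positive integer, where the two singular terms are read as a limit
    (∀ m : ℕ+,
      Tendsto (fun x : ℝ => RamanujanPsi.logSin x - Real.pi / 2 * RamanujanPsi.logTerm x m)
        (𝓝[≠] (m : ℝ)) (𝓝 (RamanujanPsi.logLimit m)) ∧
      -Real.eulerMascheroniConstant = RamanujanPsi.gammaRHSInt m) ∧
    -- equivalence with the formula for `ψ(x + 1)`: the two errors agree
    (∀ x : ℝ, 0 < x → (∀ m : ℕ+, x ≠ m) →
      RamanujanPsi.psi (x + 1) - RamanujanPsi.psiRHS x =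
        -Real.eulerMascheroniConstant - RamanujanPsi.gammaRHS x) := by
  open RamanujanPsi in
  refine ⟨fun x hx => ⟨summable_ratTerm x, summable_expPlusTerm x, summable_expMinusTerm hx,
    summable_logTerm hx, fun k => ⟨summable_sinTerm x k, summable_cosTerm x k⟩,
    summable_trigTerm hx⟩, fun x hx hn => ?_, fun m => ⟨tendsto_logSin_sub_logTerm m, ?_⟩,
    fun x hx hn => psi_sub_psiRHS hx hn⟩
  · rw [← gammaExt_of_ne hn, gammaExt_eq_neg_eulerMascheroniConstant hx]
  · rw [← gammaExt_pnat, gammaExt_eq_neg_eulerMascheroniConstant (by positivity)]
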